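/- Let $p$ be a prime, let $s\ge 1$, $q=p^s$, and let $\mathbb{F}_q$ be the finite field with $q$ elements. For integers $k\ge 0$ and $N\ge 1$ define in $\mathbb{F}_q[T]$ the power sums $$S'_k(N)=\sum_{\substack{n\ \text{monic}\\ \deg n=k}} n^N,\qquad S_k(N)=\sum_{\deg n<k} n^N,$$ where $\deg 0=-\infty$. For $m\ge 0$ let $V_m(N)$ be the set of tuples $(X_1,\dots,X_m)$ of positive integers with $X_1+\dots+X_m=N$ such that there is no carryover of $p$-adic digits in this sum (i.e. in each place the base-$p$ digits of $X_1,\dots,X_m$ add up to at most $p-1$) and $p^s-1$ divides $X_j$ for all $1\le j\le m-1$. For $m\ge 1$ let $U_m(N)$ be the set of tuples $(X_1,\dots,X_m)$ of nonnegative integers with $X_1+\dots+X_m=N$, with no carryover of $p$-adic digits in this sum, and such that $X_j>0$ and $(p^s-1)\mid X_j$ for all $1\le j\le m-1$ (no such condition on $X_m$). The weight of a tuple is $wt(X_1,\dots,X_m)=X_1+2X_2+\dots+mX_m$. The greedy element of a nonempty finite set $W$ of $m$-tuples of nonnegative integers is the tuple $(G_1,\dots,G_m)\in W$ for which the reversed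 tuple $(G_m,G_{m-1},\dots,G_1)$ is lexicographically largest. Theorem 1.4. For all $k\ge 0$ and $N\ge 1$: (a) $S'_k(N)\neq 0$ if and only if $U_{k+1}(N)\neq\emptyset$. (b) $S_k(N)\neq 0$ if and only if $V_k(N)\neq\emptyset$ and $p^s-1$ divides $N$. (c) If $S'_k(N)\neq 0$, then the degree of $S'_k(N)$ in $T$ is $wt(G)-N$, where $G$ is the greedy element of $U_{k+1}(N)$. -/

import Mathlib

open Polynomial

/-- The polynomials `n` over a finite field with `deg n < k` (with `deg 0 = -∞`) form a finite
set. -/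
theorem finite_degree_lt (F : Type*) [Field F] [Finite F] (k : ℕ) :
    {n : F[X] | n.degree < (k : WithBot ℕ)}.Finite := by
  have h : Finite (degreeLT F k) :=
    Finite.of_injective _ (degreeLTEquiv F k).injective
  refine (Set.toFinite (degreeLT F k : Set F[X])).subset ?_
  intro n hn
  exact mem_degreeLT.2 hn

/-- The monic polynomials of degree `k` over a finite field form a finite set. -/
theorem finite_monic_degree_eq (F : Type*) [Field F] [Finite F] (k : ℕ) :
    {n : F[X] | n.Monic ∧ n.degree = (k : WithBot ℕ)}.Finite := by
  refine (finite_degree_lt F (k + 1)).subset ?_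
  rintro n ⟨-, hn⟩
  change n.degree < ((k + 1 : ℕ) : WithBot ℕ)
  rw [hn]
  exact_mod_cast Nat.lt_succ_self k

/-- `S'_k(N)`: the sum of `n ^ N` over the monic polynomials `n` of degree `k`. -/
noncomputable def monicPowerSum (F : Type*) [Field F] [Finite F] (k N : ℕ) : F[X] :=
  ∑ n ∈ (finite_monic_degree_eq F k).toFinset, n ^ N

/-- `S_k(N)`: the sum of `n ^ N` over all polynomials `n` of degree less than `k`. -/
noncomputable def powerSum (F : Type*) [Field F] [Finite F] (k N : ℕ) : F[X] :=
  ∑ n ∈ (finite_degree_lt F k).toFinset, n ^ N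

/-- There is no carryover of `p`-adic digits in the sum `∑ j, X j`: in each place `i`, the
`i`-th digits `X j / p ^ i % p` add up to less than `p`. -/
def NoCarry (p : ℕ) {m : ℕ} (X : Fin m → ℕ) : Prop :=
  ∀ i : ℕ, ∑ j, X j / p ^ i % p < p

/-- `U_m(N)`: the `m`-tuples of nonnegative integers with sum `N`, without carryover of `p`-adic
digits, whose entries other than the last one are positive multiples of `p ^ s - 1`.
The `j`-th entry in the usual numbering from `1` is `X (j - 1)`. -/
def tuplesU (p s m N : ℕ) : Set (Fin m → ℕ) :=
  {X | ∑ j, X j = N ∧ NoCarry p X ∧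
    ∀ j : Fin m, (j : ℕ) + 1 < m → 0 < X j ∧ p ^ s - 1 ∣ X j}

/-- `V_m(N)`: the valid compositions of `N` of length `m`, that is, the `m`-tuples of positive
integers with sum `N`, without carryover of `p`-adic digits, whose entries other than the last
one are multiples of `p ^ s - 1`. -/
def validCompositions (p s m N : ℕ) : Set (Fin m → ℕ) :=
  {X | (∀ j, 0 < X j) ∧ ∑ j, X j = N ∧ NoCarry p X ∧
    ∀ j : Fin m, (j : ℕ) + 1 < m → p ^ s - 1 ∣ X j}

/-- The weight `X_1 + 2 X_2 + ⋯ + m X_m` of an `m`-tuple. -/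
def tupleWeight {m : ℕ} (X : Fin m → ℕ) : ℕ :=
  ∑ j : Fin m, ((j : ℕ) + 1) * X j

/-- `G` is the greedy element of `W`: it lies in `W`, and its reversal `(G_m, …, G_1)` is
lexicographically largest among the reversals of the elements of `W`. -/
def IsGreedy {m : ℕ} (W : Set (Fin m → ℕ)) (G : Fin m → ℕ) : Prop :=
  G ∈ W ∧ ∀ X ∈ W, toLex (fun j => X (Fin.rev j)) ≤ toLex (fun j => G (Fin.rev j))

/-! Expand `n ^ N` by the multinomial theorem and sum over the coefficients of `n`. The term of an
exponent tuple `x` is nonzero exactly when `x` lies in `U_{k+1}(N)`: absence of carries makes the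
multinomial coefficient prime to `p`, and `∑ c, c ^ j` over `F` is nonzero only for positive
multiples of `q - 1`. Its monomial has degree `wt(x) - N`, so (a) and (c) follow once the maximal
weight is attained only by the greedy element. For (b), the greedy element of `U_k(N)` has a last
entry at least that of any valid composition, so it is itself valid and its term survives.

The heart is that a tuple of maximal weight is greedy (`isGreedy_of_tupleWeight_le`). Maximal weight
means minimal total of the partial sums `X_1 + ⋯ + X_l`. Each of them is built from atoms, powers `p
^ i` available as often as the digit of `N` says. Only the number `c_r` of atoms in each class `r`
of `i` modulo `s` matters for divisibility by `q - 1`, which holds iff `c_r = p d_r - d_{r-1}` for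
an integer vector `d`. Taking the cheapest atoms for each `d` relaxes tuples to chains of vectors
that increase in all coordinates, without requiring nested sets of atoms.

Two facts solve the relaxed problem. In a cheapest chain every member is as cheap as the members
above it permit (`IsOptimalChain.cost_le`): submodularity of the cost reduces a cheaper competitor
to one below the member, and then `lowerChain` makes the whole chain cheaper. And some cheapest
chain is nested (`exists_nested_chain`), so it comes from a tuple. Hence a tuple of maximal weight
yields a cheapest chain, and cheapness from the top down is greediness. -/

/-! ### Growing sequences and their cumulative sums -/

/-- A sequence of sizes `g n`, extended by `0` to negative `n`, which is nondecreasing and grows by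
a factor of at least `p ^ s` every `p - 1` steps. -/
structure GrowingSizes (p s : ℕ) (g : ℤ → ℤ) : Prop where
  neg : ∀ n < 0, g n = 0
  mono : Monotone g
  gap : ∀ n, (p : ℤ) ^ s * g n ≤ g (n + ((p : ℤ) - 1))

/-- The sum of the sizes `g k` over `0 ≤ k < n`. -/
def cumul (g : ℤ → ℤ) (n : ℤ) : ℤ := ∑ k ∈ Finset.range n.toNat, g k

theorem cumul_of_nonpos {g : ℤ → ℤ} {n : ℤ} (hn : n ≤ 0) : cumul g n = 0 := by
  simp [cumul, Int.toNat_of_nonpos hn]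

theorem cumul_natCast (g : ℤ → ℤ) (n : ℕ) : cumul g n = ∑ k ∈ Finset.range n, g k := by
  simp [cumul]

/-- A geometric series with ratio `1 / q`, multiplied out to stay in the integers. -/
theorem geometric_sum_le {q β : ℤ} (hq : 1 ≤ q) (hβ : 0 ≤ β) (m : ℕ) (x : ℕ → ℤ)
    (hx : ∀ j ≤ m, q ^ (m - j) * x j ≤ β) :
    (q - 1) * ∑ j ∈ Finset.range (m + 1), x j ≤ q * β := by
  induction m generalizing x with
  | zero =>
    have := hx 0 le_rfl
    simp at this ⊢
    nlinarith
  | succ m ih =>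
    have h1 := ih (fun j => q * x j) (fun j hj => by
      have := hx j (by omega)
      rw [show m + 1 - j = m - j + 1 by omega, pow_succ] at this
      linarith)
    have h2 := hx (m + 1) le_rfl
    simp only [Nat.sub_self, pow_zero, one_mul] at h2
    rw [Finset.sum_range_succ]
    rw [← Finset.mul_sum] at h1
    have h3 : (q - 1) * ∑ j ∈ Finset.range (m + 1), x j ≤ β := by
      have : q * ((q - 1) * ∑ j ∈ Finset.range (m + 1), x j) ≤ q * β := by linarith
      exact le_of_mul_le_mul_left this (by linarith)
    nlinarith

namespace GrowingSizes

variable {p s : ℕ} {g : ℤ → ℤ}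

theorem nonneg (hg : GrowingSizes p s g) (n : ℤ) : 0 ≤ g n := by
  rcases lt_or_ge n 0 with h | h
  · exact (hg.neg n h).ge
  · have := hg.mono (show (-1 : ℤ) ≤ n by omega)
    rwa [hg.neg (-1) (by norm_num)] at this

theorem cumul_succ (hg : GrowingSizes p s g) (n : ℤ) : cumul g (n + 1) = cumul g n + g n := by
  rcases lt_or_ge n 0 with h | h
  · rw [cumul_of_nonpos (by omega), cumul_of_nonpos h.le, hg.neg n h, add_zero]
  · lift n to ℕ using h
    rw [← Nat.cast_succ, cumul_natCast, cumul_natCast, Finset.sum_range_succ]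

theorem cumul_add (hg : GrowingSizes p s g) (n : ℤ) (k : ℕ) :
    cumul g (n + k) = cumul g n + ∑ i ∈ Finset.range k, g (n + i) := by
  induction k with
  | zero => simp
  | succ k ih =>
    rw [Finset.sum_range_succ, Nat.cast_succ, ← add_assoc, hg.cumul_succ, ih, add_assoc]

theorem cumul_mono (hg : GrowingSizes p s g) : Monotone (cumul g) := by
  intro a b hab
  obtain ⟨k, rfl⟩ := Int.le.dest hab
  rw [hg.cumul_add]
  have := Finset.sum_nonneg (s := Finset.range k) (fun i _ => hg.nonneg (a + i))
  linarith

/-- Discrete convexity: the increments of `cumul` are nondecreasing, so moving two arguments towards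
each other with fixed sum cannot raise the total. -/
theorem cumul_swap (hg : GrowingSizes p s g) {a b x : ℤ} (hax : a ≤ x) (hxb : x ≤ b) :
    cumul g x + cumul g (a + b - x) ≤ cumul g a + cumul g b := by
  obtain ⟨k, rfl⟩ := Int.le.dest hax
  have h1 := hg.cumul_add a k
  have h2 := hg.cumul_add (a + b - (a + k)) k
  rw [show a + b - (a + k) + k = b by ring] at h2
  have h3 : ∑ i ∈ Finset.range k, g (a + i) ≤ ∑ i ∈ Finset.range k, g (a + b - (a + k) + i) :=
    Finset.sum_le_sum fun i _ => hg.mono (by linarith)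
  linarith

theorem pow_gap (hg : GrowingSizes p s g) (n : ℤ) (i : ℕ) :
    ((p : ℤ) ^ s) ^ i * g (n - ((p : ℤ) - 1) * i) ≤ g n := by
  induction i with
  | zero => simp
  | succ i ih =>
    refine le_trans ?_ ih
    have := hg.gap (n - ((p : ℤ) - 1) * (i + 1 : ℕ))
    rw [pow_succ, mul_assoc]
    refine mul_le_mul_of_nonneg_left (this.trans (hg.mono ?_)) (by positivity)
    push_cast
    linarith

/-- Blocks of `p - 1` consecutive sizes, read downwards from `n - 1`, shrink by a factor `p ^ s`
each; this is the resulting geometric series without denominators. -/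
theorem cumul_le (hg : GrowingSizes p s g) (hp : 2 ≤ p) (n : ℤ) :
    ((p : ℤ) ^ s - 1) * cumul g n ≤ ((p : ℤ) - 1) * ((p : ℤ) ^ s * g (n - 1)) := by
  have hp1 : (1 : ℤ) ≤ p - 1 := by
    have : (2 : ℤ) ≤ p := by exact_mod_cast hp
    linarith
  have hq : (1 : ℤ) ≤ (p : ℤ) ^ s := one_le_pow₀ (by linarith)
  induction h : n.toNat using Nat.strong_induction_on generalizing n with
  | _ N ih =>
    rcases le_or_gt n 0 with hn | hn
    · rw [cumul_of_nonpos hn]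
      have := hg.nonneg (n - 1)
      have : 0 ≤ (p : ℤ) ^ s * g (n - 1) := by positivity
      nlinarith
    · have h1 := ih (n - (p - 1)).toNat (by omega) (n - (p - 1)) rfl
      have h2 := hg.cumul_add (n - (p - 1)) (p - 1)
      have hcast : ((p - 1 : ℕ) : ℤ) = (p : ℤ) - 1 := by
        push_cast [Nat.cast_sub (show 1 ≤ p by omega)]; ring
      rw [hcast, sub_add_cancel] at h2
      have h3 : ∑ i ∈ Finset.range (p - 1), g (n - (p - 1) + i) ≤ (p - 1) * g (n - 1) := by
        calc _ ≤ ∑ i ∈ Finset.range (p - 1), g (n - 1) :=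
              Finset.sum_le_sum fun i hi => hg.mono (by
                have := Finset.mem_range.1 hi
                omega)
          _ = _ := by rw [Finset.sum_const, Finset.card_range, nsmul_eq_mul, hcast]
      have h4 := hg.gap (n - (p - 1) - 1)
      rw [show n - ((p : ℤ) - 1) - 1 + (p - 1) = n - 1 by ring] at h4
      rw [h2, mul_add]
      have h5 : ((p : ℤ) - 1) * ((p : ℤ) ^ s * g (n - (p - 1) - 1)) ≤ (p - 1) * g (n - 1) :=
        mul_le_mul_of_nonneg_left h4 (by linarith)
      have h6 := mul_le_mul_of_nonneg_left h3 (by linarith : (0 : ℤ) ≤ (p : ℤ) ^ s - 1)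
      nlinarith

end GrowingSizes

/-! ### Atoms in residue classes modulo `s` -/

/-- Sizes of atoms of `s` classes: in each class they form a growing sequence, and the atoms of
class `r` are powers `p ^ i` with `i ≡ r` modulo `s`. -/
structure AtomSizes (p s : ℕ) (g : ZMod s → ℤ → ℤ) : Prop where
  growing : ∀ r, GrowingSizes p s (g r)
  shape : ∀ r n, 0 ≤ n → ∃ i : ℕ, (i : ZMod s) = r ∧ g r n = (p : ℤ) ^ i

/-- The vector `p d_r - d_{r-1}`, with cyclic indices. -/
def cyclicDiff (p : ℕ) {s : ℕ} (d : ZMod s → ℤ) (r : ZMod s) : ℤ := p * d r - d (r - 1)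

/-- The total size of the smallest `cyclicDiff p d r` atoms of each class `r`. -/
def cost (p : ℕ) {s : ℕ} [NeZero s] (g : ZMod s → ℤ → ℤ) (d : ZMod s → ℤ) : ℤ :=
  ∑ r, cumul (g r) (cyclicDiff p d r)

theorem AtomSizes.pos {p s : ℕ} {g : ZMod s → ℤ → ℤ} (hg : AtomSizes p s g) (hp : 2 ≤ p) {r : ZMod s} {n : ℤ} (hn : 0 ≤ n) :
    0 < g r n := by
  obtain ⟨i, -, h⟩ := hg.shape r n hn
  rw [h]
  positivity

section

variable {p s : ℕ} [NeZero s] {g : ZMod s → ℤ → ℤ}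

/-- Adds up the bounds of `AtomSizes.mul_le_of_le` over all classes. -/
theorem sum_pow_val_sub (p : ℕ) (t : ZMod s) :
    ((p : ℤ) - 1) * ∑ r : ZMod s, (p : ℤ) ^ (r - t).val = (p : ℤ) ^ s - 1 := by
  have h1 : ∑ r : ZMod s, (p : ℤ) ^ (r - t).val = ∑ u : ZMod s, (p : ℤ) ^ u.val :=
    Fintype.sum_equiv (Equiv.subRight t) _ _ (fun r => by simp)
  have h2 : ∑ u : ZMod s, (p : ℤ) ^ u.val = ∑ k ∈ Finset.range s, (p : ℤ) ^ k := by
    refine Finset.sum_nbij' ZMod.val (fun k => (k : ZMod s)) ?_ ?_ ?_ ?_ ?_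
    · intro a _; simpa using ZMod.val_lt a
    · intro a _; simp
    · intro a _; simp
    · intro a ha; exact ZMod.val_cast_of_lt (by simpa using ha)
    · intro a _; rfl
  rw [h1, h2, mul_comm, geom_sum_mul]

namespace AtomSizes

/-- Atoms of different classes differ by the power of `p` prescribed by the classes. -/
theorem mul_le_of_le (hg : AtomSizes p s g) (hp : 2 ≤ p) {r t : ZMod s} (hrt : r ≠ t) {a b : ℤ}
    (hb : 0 ≤ b) (h : g r a ≤ g t b) :
    (p : ℤ) ^ s * g r a ≤ (p : ℤ) ^ (r - t).val * g t b := by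
  rcases lt_or_ge a 0 with ha | ha
  · rw [(hg.growing r).neg a ha]
    have := (hg.growing t).nonneg b
    simp only [mul_zero]
    positivity
  obtain ⟨i, hi, hi'⟩ := hg.shape r a ha
  obtain ⟨j, hj, hj'⟩ := hg.shape t b hb
  have hp1 : (1 : ℤ) < p := by exact_mod_cast hp
  rw [hi', hj'] at h ⊢
  have hij : i ≤ j := (pow_le_pow_iff_right₀ hp1).1 h
  rw [← pow_add, ← pow_add]
  refine pow_le_pow_right₀ hp1.le ?_
  -- `j - i` is a natural number congruent to `t - r ≠ 0`, hence at least `s - (r - t).val`.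
  have h1 : ((j - i : ℕ) : ZMod s) = -(r - t) := by
    rw [Nat.cast_sub hij, hi, hj]; ring
  have hne : r - t ≠ 0 := sub_ne_zero.2 hrt
  have h2 : (-(r - t)).val = s - (r - t).val := by
    have : NeZero (r - t) := ⟨hne⟩
    exact ZMod.val_neg_of_ne_zero _
  have h3 : (-(r - t)).val ≤ j - i := by
    rw [← h1, ZMod.val_natCast]
    exact Nat.mod_le _ _
  have := ZMod.val_lt (r - t)
  omega

/-- If `e` is cheaper than `v`, there is a class in which `e` lacks an atom of `v` that is larger
than each atom which `e` has in addition to those of `v`. -/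
theorem exists_dominant_class (hg : AtomSizes p s g) (hp : 2 ≤ p) {a b : ZMod s → ℤ}
    (hab : ∑ r, cumul (g r) (a r) < ∑ r, cumul (g r) (b r)) :
    ∃ t, a t < b t ∧ 0 < b t ∧ ∀ r, b r < a r → g r (b r) ≤ g t (b t - 1) := by
  classical
  have hp1 : (2 : ℤ) ≤ p := by exact_mod_cast hp
  have hq : (1 : ℤ) < (p : ℤ) ^ s := one_lt_pow₀ (by linarith) (NeZero.ne s)
  set W := Finset.univ.filter fun r => a r < b r with hW
  have hWne : W.Nonempty := by
    by_contra hne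
    rw [Finset.not_nonempty_iff_eq_empty] at hne
    refine absurd hab (not_lt.2 (Finset.sum_le_sum fun r _ => ?_))
    refine (hg.growing r).cumul_mono (not_lt.1 fun h => ?_)
    have : r ∈ W := by simp [hW, h]
    simp [hne] at this
  -- Among the classes where `a` falls short, take the one in which the largest atom of `b` is
  -- biggest.
  obtain ⟨t, ht, hmax⟩ := Finset.exists_max_image W (fun r => g r (b r - 1)) hWne
  have hmemW : ∀ r, r ∈ W ↔ a r < b r := by intro r; simp [hW]
  have hbt : 0 < b t := by
    by_contra hbt
    refine absurd hab (not_lt.2 (Finset.sum_le_sum fun r _ => ?_))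
    rcases lt_or_ge (a r) (b r) with h | h
    · have h1 := hmax r ((hmemW r).2 h)
      rw [(hg.growing t).neg (b t - 1) (by omega)] at h1
      have h2 : b r ≤ 0 := by
        by_contra h2
        exact absurd (hg.pos hp (show 0 ≤ b r - 1 by omega)) (not_lt.2 h1)
      rw [cumul_of_nonpos h2, cumul_of_nonpos (by omega)]
    · exact (hg.growing r).cumul_mono h
  refine ⟨t, (hmemW t).1 ht, hbt, fun u hu => ?_⟩
  -- With `q = p ^ s` and `β = g u (b u)`: otherwise `b` exceeds `a` outside `u` by at most `(q - p)
  -- / (q - 1) * β < β`, but falls short by at least `β` in `u`.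
  by_contra hlt
  push Not at hlt
  have hbu : 0 ≤ b u := by
    by_contra hbu
    rw [(hg.growing u).neg (b u) (by omega)] at hlt
    exact absurd ((hg.growing t).nonneg (b t - 1)) (not_le.2 hlt)
  have key : ∀ r, r ≠ u → ((p : ℤ) ^ s - 1) * (cumul (g r) (b r) - cumul (g r) (a r)) ≤
      ((p : ℤ) - 1) * ((p : ℤ) ^ (r - u).val * g u (b u)) := by
    intro r hr
    have hβ := (hg.growing u).nonneg (b u)
    rcases lt_or_ge (a r) (b r) with h | h
    · have h1 := (hg.growing r).cumul_le hp (b r)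
      have h2 := hg.mul_le_of_le hp hr hbu ((hmax r ((hmemW r).2 h)).trans hlt.le)
      have h3 : 0 ≤ cumul (g r) (a r) := by
        have := (hg.growing r).cumul_mono (min_le_left (a r) 0)
        rwa [cumul_of_nonpos (min_le_right _ _)] at this
      nlinarith
    · have h1 := (hg.growing r).cumul_mono h
      have h2 : 0 ≤ ((p : ℤ) - 1) * ((p : ℤ) ^ (r - u).val * g u (b u)) :=
        mul_nonneg (by linarith) (by positivity)
      nlinarith
  have hu' : cumul (g u) (b u) - cumul (g u) (a u) ≤ - g u (b u) := by
    have h1 := (hg.growing u).cumul_mono (show b u + 1 ≤ a u by omega)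
    rw [(hg.growing u).cumul_succ] at h1
    linarith
  have hsum := Finset.sum_le_sum fun r (hr : r ∈ Finset.univ.erase u) =>
    key r (Finset.ne_of_mem_erase hr)
  rw [← Finset.mul_sum, ← Finset.mul_sum, ← Finset.sum_mul] at hsum
  have hG := sum_pow_val_sub p u
  rw [← Finset.add_sum_erase _ _ (Finset.mem_univ u)] at hG
  simp only [sub_self, ZMod.val_zero, pow_zero] at hG
  have hD : 0 < ∑ r, (cumul (g r) (b r) - cumul (g r) (a r)) := by
    rw [Finset.sum_sub_distrib]; linarith
  rw [← Finset.add_sum_erase _ _ (Finset.mem_univ u)] at hD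
  have hβ := hg.pos hp (r := u) hbu
  set G := ∑ r ∈ Finset.univ.erase u, (p : ℤ) ^ (r - u).val
  set S := ∑ r ∈ Finset.univ.erase u, (cumul (g r) (b r) - cumul (g r) (a r))
  have h1 : ((p : ℤ) - 1) * (G * g u (b u)) = ((p : ℤ) ^ s - 1 - (p - 1)) * g u (b u) := by
    rw [← hG]; ring
  rw [h1] at hsum
  have h2 : g u (b u) < S := by linarith
  have h3 : ((p : ℤ) ^ s - 1) * g u (b u) < ((p : ℤ) ^ s - 1) * S :=
    mul_lt_mul_of_pos_left h2 (by linarith)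
  nlinarith

end AtomSizes

end

/-! ### Chains of vectors and their lowering -/

/-- Chains `0 = D 0 < D 1 < ⋯ < D m ≤ t` of integer vectors, where `<` means strict inequality in
all coordinates, such that all `cyclicDiff p (D j)` are bounded by `B`. -/
structure BoxedChain (p : ℕ) {s : ℕ} (B t : ZMod s → ℤ) (m : ℕ) (D : ℕ → ZMod s → ℤ) : Prop where
  zero : D 0 = 0
  step : ∀ j < m, ∀ r, D j r + 1 ≤ D (j + 1) r
  le_box : ∀ j ≤ m, ∀ r, cyclicDiff p (D j) r ≤ B r
  le_cap : ∀ j ≤ m, ∀ r, D j r ≤ t r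

/-- The sum of the costs of the members of a chain. -/
def chainCost (p : ℕ) {s : ℕ} [NeZero s] (g : ZMod s → ℤ → ℤ) (m : ℕ) (D : ℕ → ZMod s → ℤ) : ℤ :=
  ∑ j ∈ Finset.range (m + 1), cost p g (D j)

theorem BoxedChain.add_le {p s m : ℕ} {B t : ZMod s → ℤ} {D : ℕ → ZMod s → ℤ}
    (h : BoxedChain p B t m D) {i j : ℕ} (hij : i ≤ j) (hj : j ≤ m) (r : ZMod s) :
    D i r + ((j : ℤ) - i) ≤ D j r := by
  induction j, hij using Nat.le_induction with
  | base => simp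
  | succ j hij ih =>
    have h1 := ih (by omega)
    have h2 := h.step j (by omega) r
    push_cast
    linarith

theorem BoxedChain.le {p s m : ℕ} {B t : ZMod s → ℤ} {D : ℕ → ZMod s → ℤ}
    (h : BoxedChain p B t m D) {j : ℕ} (hj : j ≤ m) (r : ZMod s) : (j : ℤ) ≤ D j r := by
  have := h.add_le (Nat.zero_le j) hj r
  simpa [h.zero] using this

open Classical in
/-- Lower by one all coordinates in which the part of a chain from `D j` to `v = D m` rises as
slowly as possible and in which `e` is smaller than `v`. -/
noncomputable def lowerChain {s : ℕ} (e v : ZMod s → ℤ) (m : ℕ) (D : ℕ → ZMod s → ℤ) (j : ℕ)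
    (r : ZMod s) : ℤ :=
  D j r - if e r < v r ∧ D j r = v r - ((m : ℤ) - j) then 1 else 0

section

variable {p s m : ℕ} {B t e : ZMod s → ℤ} {D : ℕ → ZMod s → ℤ}

/-- A `cyclicDiff` grows only where coordinate `r - 1` drops and `r` stays. If `e r < D m r`, the
slack in coordinate `r` keeps it at most that of `D m`; otherwise it is bounded by that of `e`. The
condition `m ≤ e` keeps `D 0` fixed. -/
theorem BoxedChain.lower (hp : 2 ≤ p) (h : BoxedChain p B t m D) (hme : ∀ r, (m : ℤ) ≤ e r)
    (heB : ∀ r, cyclicDiff p e r ≤ B r) :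
    BoxedChain p B t m (lowerChain e (D m) m D) := by
  have hp1 : (2 : ℤ) ≤ p := by exact_mod_cast hp
  refine ⟨?_, ?_, ?_, ?_⟩
  · funext r
    have := hme r
    rw [lowerChain, if_neg, h.zero]
    · simp
    · rintro ⟨h1, h2⟩
      simp only [h.zero, Pi.zero_apply] at h2
      push_cast at h2
      linarith
  · intro j hj r
    have h1 := h.step j hj r
    have h2 := h.add_le (show j + 1 ≤ m by omega) le_rfl r
    unfold lowerChain
    push_cast at h2 ⊢
    split_ifs with h3 h4 h4
    · linarith
    · linarith
    -- If only the upper of two neighbours drops, they differed by at least two.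
    · by_contra hlt
      exact h3 ⟨h4.1, by linarith⟩
    · linarith
  · intro j hj r
    have h0 := h.le_box j hj r
    have h0e := heB r
    have h0m := h.le_box m le_rfl r
    have h1 := h.add_le hj le_rfl r
    have hjm : (0 : ℤ) ≤ (m : ℤ) - j := by
      have : (j : ℤ) ≤ m := by exact_mod_cast hj
      linarith
    have hmul : (m : ℤ) - j ≤ (p - 1) * ((m : ℤ) - j) := by nlinarith
    unfold lowerChain cyclicDiff at *
    dsimp only at *
    split_ifs with h3 h4 h4
    · linarith
    · linarith
    · have hv := h4.2
      by_cases her : e r < D m r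
      · have h5 : D j r ≤ D m r - ((m : ℤ) - j) - 1 := by
          by_contra hlt
          exact h3 ⟨her, by linarith⟩
        have h6 : (p : ℤ) * D j r ≤ p * (D m r - ((m : ℤ) - j) - 1) :=
          mul_le_mul_of_nonneg_left h5 (by linarith)
        linarith
      · have h5 : D j r ≤ e r - ((m : ℤ) - j) := by linarith
        have h6 : (p : ℤ) * D j r ≤ p * (e r - ((m : ℤ) - j)) :=
          mul_le_mul_of_nonneg_left h5 (by linarith)
        linarith [h4.1]
    · linarith
  · intro j hj r
    have := h.le_cap j hj r
    unfold lowerChain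
    split_ifs <;> linarith

/-- In a class where `v = D m` exceeds `e`, lowering the chain saves most of the largest atom. -/
theorem BoxedChain.saving_of_lt {g : ZMod s → ℤ → ℤ} {r : ZMod s} (hg : GrowingSizes p s (g r))
    (hp : 2 ≤ p) (h : BoxedChain p B t m D) (her : e r < D m r) :
    ((p : ℤ) ^ s * ((p : ℤ) ^ s - 1) - 1) * g r (cyclicDiff p (D m) r - 1) ≤
      (p : ℤ) ^ s * ((p : ℤ) ^ s - 1) * ∑ j ∈ Finset.range (m + 1),
        (cumul (g r) (cyclicDiff p (D j) r) -
          cumul (g r) (cyclicDiff p (lowerChain e (D m) m D j) r)) := by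
  have hp1 : (2 : ℤ) ≤ p := by exact_mod_cast hp
  have hq : (1 : ℤ) ≤ (p : ℤ) ^ s := one_le_pow₀ (by linarith)
  set γ := g r (cyclicDiff p (D m) r - 1) with hγ
  have hγ0 : 0 ≤ γ := hg.nonneg _
  set y : ℕ → ℤ := fun j => cumul (g r) (cyclicDiff p (D j) r) -
          cumul (g r) (cyclicDiff p (lowerChain e (D m) m D j) r) with hy
  -- At the top, coordinate `r` drops, so `cyclicDiff` falls by at least `p - 1 ≥ 1`, which removes
  -- the largest atom.
  have htop : γ ≤ y m := by
    have h1 : cyclicDiff p (lowerChain e (D m) m D m) r ≤ cyclicDiff p (D m) r - 1 := by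
      unfold cyclicDiff lowerChain
      rw [if_pos ⟨her, by simp⟩]
      split_ifs <;> linarith
    have h2 := hg.cumul_mono h1
    have h3 := hg.cumul_succ (cyclicDiff p (D m) r - 1)
    rw [sub_add_cancel] at h3
    simp only [hy]
    linarith
  -- Below the top, at most one atom is added to each member, at least `(p - 1) * (m - j + 1)`
  -- indices below that of `γ`. Since `m - j + 1 ≥ 2`, these add up to at most `γ / (q (q - 1))`,
  -- where `q = p ^ s`.
  have hlow : ∀ j < m, ((p : ℤ) ^ s) ^ (m - j + 1) * (- y j) ≤ γ := by
    intro j hj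
    by_cases hneg : 0 ≤ y j
    · have : 0 ≤ ((p : ℤ) ^ s) ^ (m - j + 1) := by positivity
      nlinarith
    push Not at hneg
    have h1 := h.add_le hj.le le_rfl r
    have hinc : cyclicDiff p (D j) r < cyclicDiff p (lowerChain e (D m) m D j) r := by
      by_contra hle
      have := hg.cumul_mono (not_lt.1 hle)
      simp only [hy] at hneg
      linarith
    have h2 : cyclicDiff p (lowerChain e (D m) m D j) r = cyclicDiff p (D j) r + 1 ∧
        cyclicDiff p (D j) r ≤ cyclicDiff p (D m) r - 1 - ((p : ℤ) - 1) * (m - j + 1) := by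
      unfold cyclicDiff lowerChain at *
      split_ifs at hinc ⊢ with h3 h4 h4
      · linarith
      · linarith
      · have h5 : D j r ≤ D m r - ((m : ℤ) - j) - 1 := by
          by_contra hlt
          exact h3 ⟨her, by linarith⟩
        have h6 : (p : ℤ) * D j r ≤ p * (D m r - ((m : ℤ) - j) - 1) :=
          mul_le_mul_of_nonneg_left h5 (by linarith)
        exact ⟨by linarith, by linarith [h4.2]⟩
      · linarith
    have h3 : - y j = g r (cyclicDiff p (D j) r) := by
      simp only [hy, h2.1, hg.cumul_succ]
      ring
    rw [h3]
    refine le_trans ?_ (hg.pow_gap _ (m - j + 1))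
    refine mul_le_mul_of_nonneg_left (hg.mono (h2.2.trans_eq ?_)) (by positivity)
    push_cast [Nat.cast_sub hj.le]
    ring
  rw [Finset.sum_range_succ]
  rcases m with - | m
  · simp only [Finset.range_zero, Finset.sum_empty, zero_add]
    have h4 : 0 ≤ (p : ℤ) ^ s * ((p : ℤ) ^ s - 1) := mul_nonneg (by linarith) (by linarith)
    change _ ≤ (p : ℤ) ^ s * ((p : ℤ) ^ s - 1) * y 0
    nlinarith
  · have h1 := geometric_sum_le hq hγ0 m (fun j => (p : ℤ) ^ s * ((p : ℤ) ^ s * (- y j)))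
      (fun j hj => by
        have := hlow j (by omega)
        rw [show m + 1 - j + 1 = m - j + 1 + 1 by omega, pow_succ, pow_succ] at this
        linarith)
    rw [← Finset.mul_sum, ← Finset.mul_sum, Finset.sum_neg_distrib] at h1
    set S := ∑ j ∈ Finset.range (m + 1), y j
    have h2 : (p : ℤ) ^ s * (((p : ℤ) ^ s - 1) * ((p : ℤ) ^ s * -S)) ≤ (p : ℤ) ^ s * γ := by
      linarith
    have h3 := le_of_mul_le_mul_left h2 (by linarith)
    have h4 : 0 ≤ (p : ℤ) ^ s * ((p : ℤ) ^ s - 1) := mul_nonneg (by linarith) (by linarith)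
    nlinarith

/-- In a class where `e` agrees with `v = D m`, lowering the chain costs little more than the next
atom, and nothing if the preceding coordinates also agree. -/
theorem BoxedChain.loss_of_eq {g : ZMod s → ℤ → ℤ} {r : ZMod s} (hg : GrowingSizes p s (g r))
    (hp : 2 ≤ p) (h : BoxedChain p B t m D) (her : ¬ e r < D m r) :
    ((p : ℤ) ^ s - 1) * ∑ j ∈ Finset.range (m + 1),
        (cumul (g r) (cyclicDiff p (lowerChain e (D m) m D j) r) -
          cumul (g r) (cyclicDiff p (D j) r)) ≤
      (p : ℤ) ^ s * if e (r - 1) < D m (r - 1) then g r (cyclicDiff p (D m) r) else 0 := by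
  have hp1 : (2 : ℤ) ≤ p := by exact_mod_cast hp
  have hq : (1 : ℤ) ≤ (p : ℤ) ^ s := one_le_pow₀ (by linarith)
  refine geometric_sum_le hq ?_ m _ fun j hj => ?_
  · split_ifs
    exacts [hg.nonneg _, le_rfl]
  -- An atom is added only where coordinate `r - 1` drops, and its index is then at least `(p - 1) *
  -- (m - j)` below that of the next atom of `D m`.
  by_cases h4 : e (r - 1) < D m (r - 1) ∧ D j (r - 1) = D m (r - 1) - ((m : ℤ) - j)
  · have h1 := h.add_le hj le_rfl r
    have h2 : cyclicDiff p (lowerChain e (D m) m D j) r = cyclicDiff p (D j) r + 1 := by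
      unfold cyclicDiff lowerChain
      rw [if_pos h4, if_neg fun h => her h.1]
      ring
    rw [if_pos h4.1, h2, hg.cumul_succ, add_sub_cancel_left]
    refine le_trans ?_ (hg.pow_gap _ (m - j))
    refine mul_le_mul_of_nonneg_left (hg.mono ?_) (by positivity)
    have h6 : (p : ℤ) * D j r ≤ p * (D m r - ((m : ℤ) - j)) :=
      mul_le_mul_of_nonneg_left (by linarith) (by linarith)
    push_cast [Nat.cast_sub hj]
    unfold cyclicDiff
    rw [h4.2]
    linarith
  · have h2 : cyclicDiff p (lowerChain e (D m) m D j) r = cyclicDiff p (D j) r := by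
      unfold cyclicDiff lowerChain
      rw [if_neg h4, if_neg fun h => her h.1]
      ring
    rw [h2, sub_self, mul_zero]
    split_ifs
    exacts [hg.nonneg _, le_rfl]

variable [NeZero s]

/-- With `q = p ^ s`, the class `u` of `exists_dominant_class` saves at least `(1 - 1 / (q (q - 1)))
T`, where `T` is the largest atom of `D m` in it. The other classes together lose at most `(q - 2) /
(q - 1) * T`, which leaves at least `T / q`. -/
theorem BoxedChain.chainCost_lowerChain_lt {g : ZMod s → ℤ → ℤ} (hg : AtomSizes p s g)
    (hp : 2 ≤ p) (h : BoxedChain p B t m D) (hev : ∀ r, e r ≤ D m r)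
    (hlt : cost p g e < cost p g (D m)) :
    chainCost p g m (lowerChain e (D m) m D) < chainCost p g m D := by
  have hp1 : (2 : ℤ) ≤ p := by exact_mod_cast hp
  obtain ⟨u, hu, hu0, hdom⟩ := hg.exists_dominant_class hp hlt
  set q : ℤ := (p : ℤ) ^ s with hqdef
  have hq : (2 : ℤ) ≤ q := hp1.trans (le_self_pow₀ (by linarith) (NeZero.ne s))
  set T := g u (cyclicDiff p (D m) u - 1) with hT
  have hT0 : 0 < T := hg.pos hp (by omega)
  have heu : e u < D m u := by
    have h1 := hev (u - 1)
    by_contra hle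
    have h2 : (p : ℤ) * D m u ≤ p * e u := mul_le_mul_of_nonneg_left (not_lt.1 hle) (by linarith)
    unfold cyclicDiff at hu
    linarith
  set y : ZMod s → ℤ := fun r => ∑ j ∈ Finset.range (m + 1),
        (cumul (g r) (cyclicDiff p (D j) r) -
          cumul (g r) (cyclicDiff p (lowerChain e (D m) m D j) r)) with hy
  have hyu : (q * (q - 1) - 1) * T ≤ q * (q - 1) * y u := h.saving_of_lt (hg.growing u) hp heu
  have hyr : ∀ r ∈ Finset.univ.erase u, -((p : ℤ) ^ (r - u).val * T) ≤ (q - 1) * y r := by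
    intro r hr
    have hru := Finset.ne_of_mem_erase hr
    by_cases her : e r < D m r
    · have h1 := h.saving_of_lt (hg.growing r) hp her
      have h2 : 0 ≤ (q * (q - 1) - 1) * g r (cyclicDiff p (D m) r - 1) :=
        mul_nonneg (by nlinarith) ((hg.growing r).nonneg _)
      have h3 : 0 ≤ q * ((q - 1) * y r) := by rw [← mul_assoc]; exact h2.trans h1
      have h4 := nonneg_of_mul_nonneg_right h3 (by linarith)
      refine le_trans ?_ h4
      rw [neg_nonpos]
      positivity
    · have h1 := h.loss_of_eq (hg.growing r) hp her
      have h2 : ∑ j ∈ Finset.range (m + 1),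
          (cumul (g r) (cyclicDiff p (lowerChain e (D m) m D j) r) -
          cumul (g r) (cyclicDiff p (D j) r)) = - y r := by
        simp only [hy, ← Finset.sum_neg_distrib, neg_sub]
      rw [h2] at h1
      have h3 : q * (if e (r - 1) < D m (r - 1) then g r (cyclicDiff p (D m) r) else 0) ≤
          (p : ℤ) ^ (r - u).val * T := by
        split_ifs with h4
        · refine hg.mul_le_of_le hp hru (by omega) (hdom r ?_)
          have h5 : D m r = e r := le_antisymm (not_lt.1 her) (hev r)
          unfold cyclicDiff
          rw [h5]
          linarith
        · rw [mul_zero]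
          positivity
      linarith
  have hsum := Finset.sum_le_sum hyr
  rw [Finset.sum_neg_distrib, ← Finset.sum_mul, ← Finset.mul_sum] at hsum
  have hG := sum_pow_val_sub p u
  rw [← Finset.add_sum_erase _ _ (Finset.mem_univ u)] at hG
  simp only [sub_self, ZMod.val_zero, pow_zero] at hG
  set G := ∑ r ∈ Finset.univ.erase u, (p : ℤ) ^ (r - u).val
  have hG0 : 0 ≤ G := Finset.sum_nonneg fun r _ => by positivity
  have hG2 : G ≤ q - 2 := by nlinarith
  have hdiff : chainCost p g m D - chainCost p g m (lowerChain e (D m) m D) =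
      y u + ∑ r ∈ Finset.univ.erase u, y r := by
    rw [Finset.add_sum_erase _ _ (Finset.mem_univ u)]
    simp only [chainCost, cost, hy]
    rw [Finset.sum_comm (s := Finset.univ)]
    simp only [Finset.sum_sub_distrib]
  set S := ∑ r ∈ Finset.univ.erase u, y r
  have h1 : -((q - 2) * T) ≤ (q - 1) * S := by nlinarith
  have h2 : q * -((q - 2) * T) ≤ q * ((q - 1) * S) := mul_le_mul_of_nonneg_left h1 (by linarith)
  have h3 : 0 < q * (q - 1) * (y u + S) := by nlinarith
  have h4 : 0 < y u + S := pos_of_mul_pos_right h3 (by nlinarith)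
  linarith

end

/-! ### Submodularity of the cost and optimal chains -/

section

variable {p s : ℕ} {g : ZMod s → ℤ → ℤ} {B t v e : ZMod s → ℤ} {m : ℕ} {D : ℕ → ZMod s → ℤ}

theorem cyclicDiff_sup_le (hv : ∀ r, cyclicDiff p v r ≤ B r) (he : ∀ r, cyclicDiff p e r ≤ B r)
    (r : ZMod s) : cyclicDiff p (v ⊔ e) r ≤ B r := by
  have h1 := hv r
  have h2 := he r
  unfold cyclicDiff at *
  simp only [Pi.sup_apply]
  rcases le_total (v r) (e r) with h | h
  · rw [max_eq_right h]
    linarith [le_max_right (v (r - 1)) (e (r - 1))]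
  · rw [max_eq_left h]
    linarith [le_max_left (v (r - 1)) (e (r - 1))]

theorem cyclicDiff_inf_le (hv : ∀ r, cyclicDiff p v r ≤ B r) (he : ∀ r, cyclicDiff p e r ≤ B r)
    (r : ZMod s) : cyclicDiff p (v ⊓ e) r ≤ B r := by
  have h1 := hv r
  have h2 := he r
  have hp0 : (0 : ℤ) ≤ p := by positivity
  unfold cyclicDiff at *
  simp only [Pi.inf_apply]
  rcases le_total (v (r - 1)) (e (r - 1)) with h | h
  · rw [min_eq_left h]
    linarith [mul_le_mul_of_nonneg_left (min_le_left (v r) (e r)) hp0]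
  · rw [min_eq_right h]
    linarith [mul_le_mul_of_nonneg_left (min_le_right (v r) (e r)) hp0]

theorem cost_nonneg [NeZero s] (hg : AtomSizes p s g) (d : ZMod s → ℤ) : 0 ≤ cost p g d :=
  Finset.sum_nonneg fun r _ => Finset.sum_nonneg fun k _ => (hg.growing r).nonneg k

/-- Where the comparisons at `r` and `r - 1` disagree, the `cyclicDiff`s of supremum and infimum lie
between those of `v` and `e` with the same sum, so `cumul_swap` applies; elsewhere they are the same
two numbers. -/
theorem cost_sup_add_cost_inf_le [NeZero s] (hg : AtomSizes p s g) (v e : ZMod s → ℤ) :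
    cost p g (v ⊔ e) + cost p g (v ⊓ e) ≤ cost p g v + cost p g e := by
  have hp0 : (0 : ℤ) ≤ p := by positivity
  unfold cost
  rw [← Finset.sum_add_distrib, ← Finset.sum_add_distrib]
  refine Finset.sum_le_sum fun r _ => ?_
  have hsum : cyclicDiff p (v ⊓ e) r =
      cyclicDiff p v r + cyclicDiff p e r - cyclicDiff p (v ⊔ e) r := by
    simp only [cyclicDiff, Pi.inf_apply, Pi.sup_apply]
    linear_combination (p : ℤ) * min_add_max (v r) (e r) - min_add_max (v (r - 1)) (e (r - 1))
  rw [hsum]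
  rcases le_total (v r) (e r) with h | h <;> rcases le_total (v (r - 1)) (e (r - 1)) with h' | h' <;>
    have h3 := mul_le_mul_of_nonneg_left h hp0
  · have : cyclicDiff p (v ⊔ e) r = cyclicDiff p e r := by
      simp [cyclicDiff, h, h']
    rw [this, add_sub_cancel_right, add_comm]
  · refine (hg.growing r).cumul_swap ?_ ?_ <;>
    · simp only [cyclicDiff, Pi.sup_apply, max_eq_right h, max_eq_left h']
      linarith
  · rw [add_comm (cyclicDiff p v r), add_comm (cumul _ (cyclicDiff p v r))]
    refine (hg.growing r).cumul_swap ?_ ?_ <;>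
    · simp only [cyclicDiff, Pi.sup_apply, max_eq_left h, max_eq_right h']
      linarith
  · have : cyclicDiff p (v ⊔ e) r = cyclicDiff p v r := by
      simp [cyclicDiff, h, h']
    rw [this, add_sub_cancel_left]

/-- Chains of minimal total cost. -/
structure IsOptimalChain (p : ℕ) {s : ℕ} [NeZero s] (g : ZMod s → ℤ → ℤ) (B t : ZMod s → ℤ) (m : ℕ)
    (D : ℕ → ZMod s → ℤ) : Prop where
  chain : BoxedChain p B t m D
  le : ∀ f, BoxedChain p B t m f → chainCost p g m D ≤ chainCost p g m f

theorem chainCost_congr [NeZero s] {f f' : ℕ → ZMod s → ℤ} (h : ∀ j ≤ m, f j = f' j) :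
    chainCost p g m f = chainCost p g m f' :=
  Finset.sum_congr rfl fun j hj => by rw [h j (by simpa [Nat.lt_succ_iff] using hj)]

theorem chainCost_succ [NeZero s] (f : ℕ → ZMod s → ℤ) :
    chainCost p g (m + 1) f = chainCost p g m f + cost p g (f (m + 1)) :=
  Finset.sum_range_succ _ _

theorem exists_isOptimalChain [NeZero s] (hg : AtomSizes p s g) (h : BoxedChain p B t m D) :
    ∃ f, IsOptimalChain p g B t m f := by
  classical
  have hex : ∃ n : ℕ, ∃ f, BoxedChain p B t m f ∧ chainCost p g m f = n :=
    ⟨(chainCost p g m D).toNat, D, h,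
      (Int.toNat_of_nonneg (Finset.sum_nonneg fun j _ => cost_nonneg hg (D j))).symm⟩
  obtain ⟨f, hf, hfn⟩ := Nat.find_spec hex
  refine ⟨f, hf, fun f' hf' => ?_⟩
  have h0 : 0 ≤ chainCost p g m f' := Finset.sum_nonneg fun j _ => cost_nonneg hg (f' j)
  have := Nat.find_min' hex ⟨f', hf', (Int.toNat_of_nonneg h0).symm⟩
  rw [hfn]
  omega

/-- The top member of an optimal chain is as cheap as possible. -/
theorem IsOptimalChain.cost_top_le [NeZero s] (hg : AtomSizes p s g) (hp : 2 ≤ p)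
    (h : IsOptimalChain p g B t m D) (hme : ∀ r, (m : ℤ) ≤ e r) (het : ∀ r, e r ≤ t r)
    (heB : ∀ r, cyclicDiff p e r ≤ B r) : cost p g (D m) ≤ cost p g e := by
  rcases m with - | m
  · have h0 : cost p g (D 0) = 0 := by
      simp [cost, cyclicDiff, h.chain.zero, cumul]
    rw [h0]
    exact cost_nonneg hg e
  have hD := h.chain
  -- Raising the top to `D (m + 1) ⊔ e` gives an admissible chain, so it cannot save anything. By
  -- submodularity, if `e` is cheaper than the top, so is `D (m + 1) ⊓ e`, which lies below it.
  have hsup : BoxedChain p B t (m + 1) (Function.update D (m + 1) (D (m + 1) ⊔ e)) := by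
    refine ⟨?_, ?_, ?_, ?_⟩
    · simpa using hD.zero
    · intro j hj r
      have h1 := hD.step j hj r
      rw [Function.update_of_ne (by omega)]
      rcases eq_or_ne j m with rfl | hjm
      · rw [Function.update_self]
        exact h1.trans (le_max_left _ _)
      · rwa [Function.update_of_ne (by omega)]
    · intro j hj r
      rcases eq_or_ne j (m + 1) with rfl | hjm
      · rw [Function.update_self]
        exact cyclicDiff_sup_le (hD.le_box _ le_rfl) heB r
      · rw [Function.update_of_ne hjm]
        exact hD.le_box j hj r
    · intro j hj r
      rcases eq_or_ne j (m + 1) with rfl | hjm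
      · rw [Function.update_self]
        exact max_le (hD.le_cap _ le_rfl r) (het r)
      · rw [Function.update_of_ne hjm]
        exact hD.le_cap j hj r
  have h1 := h.le _ hsup
  rw [chainCost_succ, chainCost_succ, Function.update_self,
    chainCost_congr (f := Function.update _ _ _) (f' := D)
      (fun j hj => Function.update_of_ne (by omega) _ _)] at h1
  by_contra hlt
  have h2 := cost_sup_add_cost_inf_le hg (D (m + 1)) e
  have h3 := hD.lower (e := D (m + 1) ⊓ e) hp
    (fun r => le_min (hD.le le_rfl r) (hme r)) (cyclicDiff_inf_le (hD.le_box _ le_rfl) heB)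
  have h4 := hD.chainCost_lowerChain_lt (e := D (m + 1) ⊓ e) hg hp (fun r => min_le_left _ _)
    (by linarith)
  exact absurd (h.le _ h3) (not_le.2 h4)

/-- Initial parts of optimal chains are optimal. -/
theorem IsOptimalChain.init [NeZero s] (h : IsOptimalChain p g B t m D) {l : ℕ} (hl : l < m) :
    IsOptimalChain p g B (fun r => D (l + 1) r - 1) l D := by
  have hD := h.chain
  refine ⟨⟨hD.zero, fun j hj => hD.step j (by omega), fun j hj => hD.le_box j (by omega),
    fun j hj r => ?_⟩, fun f hf => ?_⟩
  · have := hD.add_le (show j ≤ l + 1 by omega) (by omega) r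
    have h2 : (j : ℤ) ≤ l := by exact_mod_cast hj
    push_cast at this
    linarith
  -- The cap `D (l + 1) - 1` lets any competitor be glued to the upper part of `D`.
  · have hglue : BoxedChain p B t m (fun j => if j ≤ l then f j else D j) := by
      refine ⟨?_, ?_, ?_, ?_⟩
      · simpa using hf.zero
      · intro j hj r
        split_ifs with h1 h2 h2
        · exact hf.step j (by omega) r
        · have := hf.le_cap j h1 r
          rw [show j = l by omega] at this ⊢
          linarith
        · omega
        · exact hD.step j hj r
      · intro j hj r
        split_ifs with h1
        · exact hf.le_box j h1 r
        · exact hD.le_box j hj r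
      · intro j hj r
        split_ifs with h1
        · have h2 := hf.le_cap j h1 r
          have h3 := hD.le_cap (l + 1) (by omega) r
          linarith
        · exact hD.le_cap j hj r
    have h1 := h.le _ hglue
    obtain ⟨k, rfl⟩ := Nat.exists_eq_add_of_lt hl
    unfold chainCost at h1 ⊢
    rw [show l + k + 1 + 1 = l + 1 + (k + 1) by omega, Finset.sum_range_add,
      Finset.sum_range_add _ (l + 1)] at h1
    have h2 : ∑ x ∈ Finset.range (l + 1), cost p g (if x ≤ l then f x else D x) =
        ∑ x ∈ Finset.range (l + 1), cost p g (f x) :=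
      Finset.sum_congr rfl fun x hx => by
        rw [if_pos (by simpa [Nat.lt_succ_iff] using hx)]
    have h3 : ∑ x ∈ Finset.range (k + 1), cost p g (if l + 1 + x ≤ l then f (l + 1 + x)
        else D (l + 1 + x)) = ∑ x ∈ Finset.range (k + 1), cost p g (D (l + 1 + x)) :=
      Finset.sum_congr rfl fun x hx => by rw [if_neg (by omega)]
    rw [h2, h3] at h1
    linarith

/-- Every member of an optimal chain is as cheap as possible, given the members above it. -/
theorem IsOptimalChain.cost_le [NeZero s] (hg : AtomSizes p s g) (hp : 2 ≤ p)
    (h : IsOptimalChain p g B t m D) {l : ℕ} (hl : l ≤ m) (hle : ∀ r, (l : ℤ) ≤ e r)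
    (het : ∀ r, e r ≤ t r) (heD : l < m → ∀ r, e r + 1 ≤ D (l + 1) r)
    (heB : ∀ r, cyclicDiff p e r ≤ B r) : cost p g (D l) ≤ cost p g e := by
  rcases hl.eq_or_lt with rfl | hlm
  · exact h.cost_top_le hg hp hle het heB
  · exact (h.init hlm).cost_top_le hg hp hle (fun r => by linarith [heD hlm r]) heB

end

/-! ### Closing a vector to make its `cyclicDiff` nonnegative -/

section

variable {p s : ℕ} {w w' : ZMod s → ℤ}

/-- The largest vector `u ≤ w` with `u (r - 1) ≤ p * u r` for all `r`. -/
noncomputable def cyclicClosure (p : ℕ) {s : ℕ} (w : ZMod s → ℤ) (r : ZMod s) : ℤ :=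
  ⨅ k : ℕ, (p : ℤ) ^ k * w (r + k)

theorem bddBelow_cyclicClosure (hw : ∀ r, 0 ≤ w r) (r : ZMod s) :
    BddBelow (Set.range fun k : ℕ => (p : ℤ) ^ k * w (r + k)) :=
  ⟨0, by rintro _ ⟨k, rfl⟩; exact mul_nonneg (by positivity) (hw _)⟩

theorem cyclicClosure_le_term (hw : ∀ r, 0 ≤ w r) (r : ZMod s) (k : ℕ) :
    cyclicClosure p w r ≤ (p : ℤ) ^ k * w (r + k) :=
  ciInf_le (bddBelow_cyclicClosure hw r) k

theorem exists_cyclicClosure_eq (hw : ∀ r, 0 ≤ w r) (r : ZMod s) :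
    ∃ k : ℕ, cyclicClosure p w r = (p : ℤ) ^ k * w (r + k) := by
  obtain ⟨k, hk⟩ := Int.csInf_mem (Set.range_nonempty _) (bddBelow_cyclicClosure (p := p) hw r)
  exact ⟨k, hk.symm⟩

theorem cyclicClosure_le (hw : ∀ r, 0 ≤ w r) (r : ZMod s) : cyclicClosure p w r ≤ w r := by
  simpa using cyclicClosure_le_term (p := p) hw r 0

theorem cyclicClosure_sub_one_le (hw : ∀ r, 0 ≤ w r) (r : ZMod s) :
    cyclicClosure p w (r - 1) ≤ p * cyclicClosure p w r := by
  obtain ⟨k, hk⟩ := exists_cyclicClosure_eq (p := p) hw r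
  have := cyclicClosure_le_term (p := p) hw (r - 1) (k + 1)
  rw [show r - 1 + ((k + 1 : ℕ) : ZMod s) = r + k by push_cast; ring] at this
  rw [hk]
  linarith [pow_succ' (p : ℤ) k, this, mul_assoc (p : ℤ) (p ^ k) (w (r + k)),
    congrArg (· * w (r + k)) (pow_succ' (p : ℤ) k)]

/-- The infimum at `r - 1` is attained at `k = 0` or at a later term, which is `p` times a term for
`r`. -/
theorem cyclicClosure_eq_or (hw : ∀ r, 0 ≤ w r) (r : ZMod s) :
    cyclicClosure p w (r - 1) = w (r - 1) ∨
      cyclicClosure p w (r - 1) = p * cyclicClosure p w r := by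
  obtain ⟨k, hk⟩ := exists_cyclicClosure_eq (p := p) hw (r - 1)
  rcases k with - | k
  · left; simpa using hk
  · right
    refine le_antisymm (cyclicClosure_sub_one_le hw r) ?_
    have h1 := cyclicClosure_le_term (p := p) hw r k
    rw [hk, show r - 1 + ((k + 1 : ℕ) : ZMod s) = r + k by push_cast; ring, pow_succ', mul_assoc]
    exact mul_le_mul_of_nonneg_left h1 (by positivity)

theorem le_cyclicClosure (hp : 1 ≤ p) {a : ℤ} (ha : 0 ≤ a) (hw : ∀ r, a ≤ w r) (r : ZMod s) :
    a ≤ cyclicClosure p w r := by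
  refine le_ciInf fun k => ?_
  have h1 : (1 : ℤ) ≤ (p : ℤ) ^ k := one_le_pow₀ (by exact_mod_cast hp)
  have h2 := hw (r + k)
  nlinarith

theorem cyclicClosure_add_one_le (hp : 1 ≤ p) (hw : ∀ r, 0 ≤ w r)
    (hww' : ∀ r, w r + 1 ≤ w' r) (r : ZMod s) :
    cyclicClosure p w r + 1 ≤ cyclicClosure p w' r := by
  refine le_ciInf fun k => ?_
  have h1 : (1 : ℤ) ≤ (p : ℤ) ^ k := one_le_pow₀ (by exact_mod_cast hp)
  have h2 := cyclicClosure_le_term (p := p) hw r k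
  have h3 := mul_le_mul_of_nonneg_left (hww' (r + k)) (by linarith : (0 : ℤ) ≤ (p : ℤ) ^ k)
  linarith

theorem cyclicDiff_cyclicClosure_nonneg (hw : ∀ r, 0 ≤ w r) (r : ZMod s) :
    0 ≤ cyclicDiff p (cyclicClosure p w) r :=
  sub_nonneg.2 (cyclicClosure_sub_one_le hw r)

/-- If coordinate `r - 1` is kept, lowering `r` can only decrease the difference; if not, it becomes
`p` times coordinate `r` and the difference vanishes. Hence closing never raises a cost. -/
theorem cyclicDiff_cyclicClosure_eq_zero_or (hw : ∀ r, 0 ≤ w r) (r : ZMod s) :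
    cyclicDiff p (cyclicClosure p w) r = 0 ∨
      cyclicDiff p (cyclicClosure p w) r ≤ cyclicDiff p w r := by
  have h1 := mul_le_mul_of_nonneg_left (cyclicClosure_le (p := p) hw r)
    (by positivity : (0 : ℤ) ≤ p)
  unfold cyclicDiff
  rcases cyclicClosure_eq_or (p := p) hw r with h | h
  · right; linarith
  · left; linarith

theorem cyclicClosure_eq_self (hw : ∀ r, 0 ≤ w r) (hc : ∀ r, 0 ≤ cyclicDiff p w r) :
    cyclicClosure p w = w := by
  funext r
  refine le_antisymm (cyclicClosure_le hw r) (le_ciInf fun k => ?_)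
  induction k with
  | zero => simp
  | succ k ih =>
    refine ih.trans ?_
    have h1 := hc (r + (k + 1 : ℕ))
    unfold cyclicDiff at h1
    rw [show r + ((k + 1 : ℕ) : ZMod s) - 1 = r + k by push_cast; ring] at h1
    have h2 := mul_le_mul_of_nonneg_left (sub_nonneg.1 h1) (by positivity : (0 : ℤ) ≤ (p : ℤ) ^ k)
    rw [pow_succ, mul_assoc]
    exact h2

end

/-! ### Nested optimal chains -/

section

variable {p s : ℕ} [NeZero s] {g : ZMod s → ℤ → ℤ} {B t : ZMod s → ℤ} {m : ℕ}
  {D : ℕ → ZMod s → ℤ}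

theorem IsOptimalChain.closure (hg : AtomSizes p s g) (hp : 1 ≤ p) (hB : ∀ r, 0 ≤ B r)
    (h : IsOptimalChain p g B t m D) :
    IsOptimalChain p g B t m (fun j => cyclicClosure p (D j)) := by
  have hD := h.chain
  have hnn : ∀ j ≤ m, ∀ r, 0 ≤ D j r := fun j hj r => (Nat.cast_nonneg j).trans (hD.le hj r)
  refine ⟨⟨?_, ?_, ?_, ?_⟩, fun f hf => le_trans ?_ (h.le f hf)⟩
  · funext r
    simp [hD.zero, cyclicClosure]
  · intro j hj r
    exact cyclicClosure_add_one_le hp (hnn j hj.le) (hD.step j hj) r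
  · intro j hj r
    rcases cyclicDiff_cyclicClosure_eq_zero_or (p := p) (hnn j hj) r with h1 | h1
    · exact h1.trans_le (hB r)
    · exact h1.trans (hD.le_box j hj r)
  · intro j hj r
    exact (cyclicClosure_le (hnn j hj) r).trans (hD.le_cap j hj r)
  · refine Finset.sum_le_sum fun j hj => Finset.sum_le_sum fun r _ => ?_
    have hj : j ≤ m := by simpa [Nat.lt_succ_iff] using hj
    rcases cyclicDiff_cyclicClosure_eq_zero_or (p := p) (hnn j hj) r with h1 | h1
    · rw [h1, cumul_of_nonpos le_rfl]
      exact Finset.sum_nonneg fun k _ => (hg.growing r).nonneg k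
    · exact (hg.growing r).cumul_mono h1

/-- Among the chains of minimal cost there is one for which the vectors `cyclicDiff p (D j)` form
a nondecreasing sequence as well. -/
theorem exists_nested_chain (hg : AtomSizes p s g) (hp : 2 ≤ p) (hB : ∀ r, 0 ≤ B r)
    (h : BoxedChain p B t m D) :
    ∃ Z, BoxedChain p B t m Z ∧ (∀ j < m, ∀ r, cyclicDiff p (Z j) r ≤ cyclicDiff p (Z (j + 1)) r) ∧
      ∀ f, BoxedChain p B t m f → chainCost p g m Z ≤ chainCost p g m f := by
  induction m generalizing B t D with
  | zero =>
    refine ⟨D, h, by simp, fun f hf => (chainCost_congr fun j hj => ?_).le⟩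
    rw [Nat.le_zero.1 hj, h.zero, hf.zero]
  | succ m ih =>
    -- Close an optimal chain. Closedness of its top `v` gives `E 0 = 0` below and a nonnegative box
    -- for the induction.
    obtain ⟨D₀, hD₀⟩ := exists_isOptimalChain hg h
    have hnn : ∀ r, 0 ≤ cyclicDiff p (cyclicClosure p (D₀ (m + 1))) r := fun r =>
      cyclicDiff_cyclicClosure_nonneg
        (fun r => (Nat.cast_nonneg _).trans (hD₀.chain.le le_rfl r)) r
    have hopt := hD₀.closure hg (by omega) hB
    change ∀ r, 0 ≤ cyclicDiff p ((fun j => cyclicClosure p (D₀ j)) (m + 1)) r at hnn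
    generalize (fun j => cyclicClosure p (D₀ j)) = D' at hopt hnn
    have hD' := hopt.chain
    set v := D' (m + 1) with hv
    have hvD : ∀ j ≤ m, ∀ r, (m : ℤ) + 1 - j ≤ v r - D' j r := fun j hj r => by
      have := hD'.add_le (show j ≤ m + 1 by omega) le_rfl r
      push_cast at this
      linarith
    have hw1 : ∀ j ≤ m, ∀ r, 1 ≤ v r - D' j r := fun j hj r => by
      have h1 := hvD j hj r
      have h2 : (j : ℤ) ≤ m := by exact_mod_cast hj
      linarith
    have hw0 : ∀ j ≤ m, ∀ r, 0 ≤ (v - D' j) r := fun j hj r =>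
      (by norm_num : (0 : ℤ) ≤ 1).trans (hw1 j hj r)
    -- Closing the differences to `v` brings every `cyclicDiff p (E j)` below `cyclicDiff p v`.
    set E : ℕ → ZMod s → ℤ := fun j => v - cyclicClosure p (v - D' j) with hE
    have hEdiff : ∀ j r, cyclicDiff p (E j) r =
        cyclicDiff p v r - cyclicDiff p (cyclicClosure p (v - D' j)) r := fun j r => by
      simp only [hE, cyclicDiff, Pi.sub_apply]
      ring
    have hEchain : BoxedChain p (cyclicDiff p v) (fun r => v r - 1) m E := by
      refine ⟨?_, ?_, ?_, ?_⟩
      · have hv0 : ∀ r, 0 ≤ v r := fun r => (Nat.cast_nonneg _).trans (hD'.le le_rfl r)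
        simp only [hE, hD'.zero, sub_zero]
        rw [cyclicClosure_eq_self hv0 hnn, sub_self]
      · intro j hj r
        have := cyclicClosure_add_one_le (p := p) (w' := v - D' j) (by omega) (hw0 (j + 1) hj)
          (fun r => by
            have := hD'.step j (by omega) r
            simp only [Pi.sub_apply]
            linarith) r
        simp only [hE, Pi.sub_apply]
        linarith
      · intro j hj r
        rw [hEdiff]
        linarith [cyclicDiff_cyclicClosure_nonneg (p := p) (hw0 j hj) r]
      · intro j hj r
        have := le_cyclicClosure (p := p) (by omega) zero_le_one (w := v - D' j) (hw1 j hj) r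
        simp only [hE, Pi.sub_apply]
        linarith
    have hEcost : ∀ j ≤ m, cost p g (E j) ≤ cost p g (D' j) := by
      intro j hj
      have hu : ∀ r, cyclicDiff p (D' j + cyclicClosure p (v - D' j)) r =
          cyclicDiff p (D' j) r + cyclicDiff p (cyclicClosure p (v - D' j)) r := fun r => by
        simp only [cyclicDiff, Pi.add_apply]
        ring
      have hvdiff : ∀ r, cyclicDiff p v r = cyclicDiff p (D' j) r + cyclicDiff p (v - D' j) r :=
        fun r => by
          simp only [cyclicDiff, Pi.sub_apply]
          ring
      -- The vector `D' j + cyclicClosure p (v - D' j)` is an admissible competitor for the top.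
      -- Together with `E j` it adds up to `D' j + v`, so convexity turns this into a bound for the
      -- cost of `E j`.
      have htop : cost p g v ≤ cost p g (D' j + cyclicClosure p (v - D' j)) := by
        refine hopt.cost_top_le hg hp (fun r => ?_) (fun r => ?_) (fun r => ?_)
        · have h1 := le_cyclicClosure (p := p) (by omega)
            (show (0 : ℤ) ≤ (m : ℤ) + 1 - j by
              have : (j : ℤ) ≤ m := by exact_mod_cast hj
              linarith) (w := v - D' j) (hvD j hj) r
          have h2 := hD'.le (show j ≤ m + 1 by omega) r
          simp only [Pi.add_apply]
          push_cast
          linarith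
        · have h1 := cyclicClosure_le (p := p) (hw0 j hj) r
          have h2 := hD'.le_cap (m + 1) le_rfl r
          simp only [Pi.add_apply, Pi.sub_apply] at h1 ⊢
          linarith
        · rw [hu]
          rcases cyclicDiff_cyclicClosure_eq_zero_or (p := p) (hw0 j hj) r with h1 | h1
          · rw [h1, add_zero]
            exact hD'.le_box j (by omega) r
          · have h2 := hD'.le_box (m + 1) le_rfl r
            linarith [hvdiff r]
      have hswap : cost p g (E j) + cost p g (D' j + cyclicClosure p (v - D' j)) ≤
          cost p g (D' j) + cost p g v := by
        unfold cost
        rw [← Finset.sum_add_distrib, ← Finset.sum_add_distrib]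
        refine Finset.sum_le_sum fun r _ => ?_
        rw [hEdiff, hu]
        rcases cyclicDiff_cyclicClosure_eq_zero_or (p := p) (hw0 j hj) r with h1 | h1
        · rw [h1, sub_zero, add_zero, add_comm]
        · have h2 := cyclicDiff_cyclicClosure_nonneg (p := p) (hw0 j hj) r
          have h3 := hvdiff r
          have h4 := (hg.growing r).cumul_swap (a := cyclicDiff p (D' j) r) (b := cyclicDiff p v r)
            (x := cyclicDiff p v r - cyclicDiff p (cyclicClosure p (v - D' j)) r)
            (by linarith) (by linarith)
          rwa [show cyclicDiff p (D' j) r + cyclicDiff p v r - (cyclicDiff p v r -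
            cyclicDiff p (cyclicClosure p (v - D' j)) r) = cyclicDiff p (D' j) r +
            cyclicDiff p (cyclicClosure p (v - D' j)) r by ring] at h4
      linarith
    -- Induct inside the box of `v`: the result is nested below `v` and costs at most as much as
    -- `E`.
    obtain ⟨Z, hZ, hZnest, hZmin⟩ := ih hnn hEchain
    have hupd : ∀ j ≤ m, Function.update Z (m + 1) v j = Z j := fun j hj =>
      Function.update_of_ne (by omega) _ _
    refine ⟨Function.update Z (m + 1) v, ⟨?_, ?_, ?_, ?_⟩, ?_, fun f hf => ?_⟩
    · rw [hupd 0 (Nat.zero_le m), hZ.zero]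
    · intro j hj r
      rw [hupd j (by omega)]
      rcases eq_or_ne j m with rfl | hjm
      · rw [Function.update_self]
        linarith [hZ.le_cap j le_rfl r]
      · rw [hupd _ (by omega)]
        exact hZ.step j (by omega) r
    · intro j hj r
      rcases hj.eq_or_lt with rfl | hjm
      · rw [Function.update_self]
        exact hD'.le_box _ le_rfl r
      · rw [hupd j (by omega)]
        exact (hZ.le_box j (by omega) r).trans (hD'.le_box _ le_rfl r)
    · intro j hj r
      rcases hj.eq_or_lt with rfl | hjm
      · rw [Function.update_self]
        exact hD'.le_cap _ le_rfl r
      · rw [hupd j (by omega)]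
        linarith [hZ.le_cap j (by omega) r, hD'.le_cap _ le_rfl r]
    · intro j hj r
      rw [hupd j (by omega)]
      rcases eq_or_ne j m with rfl | hjm
      · rw [Function.update_self]
        exact hZ.le_box j le_rfl r
      · rw [hupd _ (by omega)]
        exact hZnest j (by omega) r
    · refine le_trans ?_ (hopt.le f hf)
      rw [chainCost_succ, chainCost_succ, Function.update_self, chainCost_congr hupd]
      have h1 : chainCost p g m E ≤ chainCost p g m D' :=
        Finset.sum_le_sum fun j hj => hEcost j (by simpa [Nat.lt_succ_iff] using hj)
      linarith [hZmin E hEchain]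

end

/-! ### Multisets of places in increasing order -/

section

/-- For a sequence `b` of multiplicities, the place `i` of the `n`-th element (counted from `0`) of
the multiset which contains each `i` with multiplicity `b i`. -/
noncomputable def place (b : ℕ → ℕ) (n : ℕ) : ℕ := sInf {i | n < ∑ k ∈ Finset.range (i + 1), b k}

variable {b : ℕ → ℕ}

theorem place_le {n i : ℕ} (h : n < ∑ k ∈ Finset.range (i + 1), b k) : place b n ≤ i :=
  Nat.sInf_le h

theorem lt_sum_place (hb : ∀ n, ∃ i, n < ∑ k ∈ Finset.range (i + 1), b k) (n : ℕ) :
    n < ∑ k ∈ Finset.range (place b n + 1), b k :=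
  Nat.sInf_mem (hb n)

theorem sum_place_le (n : ℕ) : ∑ k ∈ Finset.range (place b n), b k ≤ n := by
  rcases h : place b n with - | i
  · simp
  · by_contra hlt
    have := place_le (not_le.1 hlt)
    omega

theorem place_mono (hb : ∀ n, ∃ i, n < ∑ k ∈ Finset.range (i + 1), b k) : Monotone (place b) :=
  fun _ n' h => place_le (h.trans_lt (lt_sum_place hb n'))

theorem place_ne_zero (hb : ∀ n, ∃ i, n < ∑ k ∈ Finset.range (i + 1), b k) (n : ℕ) :
    b (place b n) ≠ 0 := by
  have h1 := lt_sum_place hb n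
  have h2 := sum_place_le (b := b) n
  rw [Finset.sum_range_succ] at h1
  omega

/-- At most `c` elements share a place. This becomes the gap condition of `GrowingSizes`. -/
theorem place_lt_place_add (hb : ∀ n, ∃ i, n < ∑ k ∈ Finset.range (i + 1), b k) {c : ℕ}
    (hc : ∀ i, b i ≤ c) (n : ℕ) : place b n < place b (n + c) := by
  by_contra h
  have h1 := lt_sum_place hb (n + c)
  have h2 := sum_place_le (b := b) n
  have h3 : ∑ k ∈ Finset.range (place b (n + c) + 1), b k ≤
      ∑ k ∈ Finset.range (place b n + 1), b k :=
    Finset.sum_le_sum_of_subset (Finset.range_mono (by omega))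
  rw [Finset.sum_range_succ _ (place b n)] at h3
  have := hc (place b n)
  omega

/-- The number of the first `n` elements at the place `i`. -/
noncomputable def placeCount (b : ℕ → ℕ) (n i : ℕ) : ℕ :=
  ((Finset.range n).filter fun k => place b k = i).card

theorem placeCount_mono {n n' : ℕ} (h : n ≤ n') (i : ℕ) : placeCount b n i ≤ placeCount b n' i :=
  Finset.card_le_card (Finset.filter_subset_filter _ (Finset.range_mono h))

theorem placeCount_le (hb : ∀ n, ∃ i, n < ∑ k ∈ Finset.range (i + 1), b k) (n i : ℕ) :
    placeCount b n i ≤ b i := by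
  have : ((Finset.range n).filter fun k => place b k = i) ⊆
      Finset.Ico (∑ k ∈ Finset.range i, b k) (∑ k ∈ Finset.range (i + 1), b k) := by
    intro k hk
    obtain ⟨-, rfl⟩ := Finset.mem_filter.1 hk
    exact Finset.mem_Ico.2 ⟨sum_place_le k, lt_sum_place hb k⟩
  refine (Finset.card_le_card this).trans ?_
  rw [Nat.card_Ico, Finset.sum_range_succ]
  omega

theorem sum_place_eq {L n : ℕ} (hn : n ≤ ∑ k ∈ Finset.range L, b k) (P : ℕ → ℕ) :
    ∑ k ∈ Finset.range n, P (place b k) = ∑ i ∈ Finset.range L, placeCount b n i * P i := by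
  have hmaps : ∀ k ∈ Finset.range n, place b k ∈ Finset.range L := by
    intro k hk
    have hk' := (Finset.mem_range.1 hk).trans_le hn
    rcases L with - | L
    · simp at hk'
    · exact Finset.mem_range.2 (Nat.lt_succ_of_le (place_le hk'))
  rw [← Finset.sum_fiberwise_of_maps_to hmaps]
  refine Finset.sum_congr rfl fun i _ => ?_
  rw [Finset.sum_congr rfl (g := fun _ => P i) fun k hk => by rw [(Finset.mem_filter.1 hk).2],
    Finset.sum_const, smul_eq_mul, placeCount]

/-- The first elements in order are the cheapest selection of their size. -/
theorem sum_place_le_sum {P y : ℕ → ℕ} (hP : Monotone P) (hy : ∀ i, y i ≤ b i) (L : ℕ) :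
    ∑ k ∈ Finset.range (∑ i ∈ Finset.range L, y i), P (place b k) ≤
      ∑ i ∈ Finset.range L, y i * P i := by
  induction L with
  | zero => simp
  | succ L ih =>
    rw [Finset.sum_range_succ, Finset.sum_range_add, Finset.sum_range_succ _ L]
    refine add_le_add ih ?_
    calc _ ≤ ∑ k ∈ Finset.range (y L), P L := Finset.sum_le_sum fun k hk => hP (place_le ?_)
      _ = _ := by simp
    have h1 := Finset.mem_range.1 hk
    have h2 : ∑ i ∈ Finset.range L, y i ≤ ∑ i ∈ Finset.range L, b i :=
      Finset.sum_le_sum fun i _ => hy i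
    have h3 := hy L
    rw [Finset.sum_range_succ]
    omega

end

/-! ### Digits and carries -/

section

theorem sum_digits_mul_pow (p : ℕ) {L Y : ℕ} (hY : Y < p ^ L) :
    ∑ i ∈ Finset.range L, Y / p ^ i % p * p ^ i = Y := by
  have : ∀ L, ∑ i ∈ Finset.range L, Y / p ^ i % p * p ^ i = Y % p ^ L := by
    intro L
    induction L with
    | zero => simp [Nat.mod_one]
    | succ L ih => rw [Finset.sum_range_succ, ih, Nat.mod_pow_succ, mul_comm]
  rw [this, Nat.mod_eq_of_lt hY]

theorem sum_mul_pow_div_pow_mod {p : ℕ} (L : ℕ) {y : ℕ → ℕ} (hy : ∀ i, y i < p)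
    (j : ℕ) : (∑ i ∈ Finset.range L, y i * p ^ i) / p ^ j % p = if j < L then y j else 0 := by
  have hp : 0 < p := (Nat.zero_le _).trans_lt (hy 0)
  induction L generalizing y j with
  | zero => simp
  | succ L ih =>
    rw [Finset.sum_range_succ']
    have h1 : ∑ i ∈ Finset.range L, y (i + 1) * p ^ (i + 1) + y 0 * p ^ 0 =
        y 0 + p * ∑ i ∈ Finset.range L, y (i + 1) * p ^ i := by
      rw [Finset.mul_sum, pow_zero, mul_one, add_comm]
      congr 1
      exact Finset.sum_congr rfl fun i _ => by ring
    rw [h1]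
    rcases j with - | j
    · simp [Nat.mod_eq_of_lt (hy 0)]
    · rw [pow_succ', ← Nat.div_div_eq_div_mul, Nat.add_mul_div_left _ _ hp,
        Nat.div_eq_of_lt (hy 0), zero_add, ih (fun i => hy (i + 1))]
      simp

/-- If no carry occurs in a sum, it commutes with the division by powers of `p`. -/
theorem sum_div_pow_of_no_carry {ι : Type*} {p : ℕ} (S : Finset ι) (X : ι → ℕ)
    (h : ∀ i, ∑ j ∈ S, X j / p ^ i % p < p) (i : ℕ) :
    (∑ j ∈ S, X j) / p ^ i = ∑ j ∈ S, X j / p ^ i := by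
  have hp : 0 < p := (Nat.zero_le _).trans_lt (h 0)
  induction i with
  | zero => simp
  | succ i ih =>
    rw [pow_succ, ← Nat.div_div_eq_div_mul, ih]
    have h1 : ∑ j ∈ S, X j / p ^ i =
        ∑ j ∈ S, X j / p ^ i % p + p * ∑ j ∈ S, X j / (p ^ i * p) := by
      rw [Finset.mul_sum, ← Finset.sum_add_distrib]
      refine Finset.sum_congr rfl fun j _ => ?_
      rw [← Nat.div_div_eq_div_mul, Nat.mod_add_div]
    rw [h1, Nat.add_mul_div_left _ _ hp, Nat.div_eq_of_lt (h i), zero_add]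

theorem sum_div_pow_mod_of_no_carry {ι : Type*} {p : ℕ} (S : Finset ι) (X : ι → ℕ)
    (h : ∀ i, ∑ j ∈ S, X j / p ^ i % p < p) (i : ℕ) :
    (∑ j ∈ S, X j) / p ^ i % p = ∑ j ∈ S, X j / p ^ i % p := by
  have h1 : ∑ j ∈ S, X j / p ^ i =
      ∑ j ∈ S, X j / p ^ i % p + p * ∑ j ∈ S, X j / (p ^ i * p) := by
    rw [Finset.mul_sum, ← Finset.sum_add_distrib]
    refine Finset.sum_congr rfl fun j _ => ?_
    rw [← Nat.div_div_eq_div_mul, Nat.mod_add_div]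
  rw [sum_div_pow_of_no_carry S X h, h1, Nat.add_mul_mod_self_left, Nat.mod_eq_of_lt (h i)]

/-- Quotients instead of digits are what Legendre's formula for factorials produces. -/
theorem noCarry_iff {p m : ℕ} (hp : 0 < p) (X : Fin m → ℕ) :
    NoCarry p X ↔ ∀ i, (∑ j, X j) / p ^ i = ∑ j, X j / p ^ i := by
  refine ⟨fun h i => sum_div_pow_of_no_carry _ X h i, fun h i => ?_⟩
  have h1 : ∑ j, X j / p ^ i = ∑ j, X j / p ^ i % p + p * ∑ j, X j / (p ^ i * p) := by
    rw [Finset.mul_sum, ← Finset.sum_add_distrib]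
    refine Finset.sum_congr rfl fun j _ => ?_
    rw [← Nat.div_div_eq_div_mul, Nat.mod_add_div]
  have h2 := h (i + 1)
  rw [pow_succ] at h2
  rw [← h2, ← Nat.div_div_eq_div_mul, h i] at h1
  have h3 := Nat.mod_add_div (∑ j, X j / p ^ i) p
  have h4 : ∑ j, X j / p ^ i % p = (∑ j, X j / p ^ i) % p := by omega
  rw [h4]
  exact Nat.mod_lt _ hp

end

/-! ### The atoms of `N` -/

section

variable {p s : ℕ}

/-- The sum of the `p`-adic digits of `Y` at the places `i < L` with `i ≡ r` modulo `s`. -/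
def classDigitSum (p L : ℕ) {s : ℕ} (Y : ℕ) (r : ZMod s) : ℕ :=
  ∑ i ∈ Finset.range L, if (i : ZMod s) = r then Y / p ^ i % p else 0

/-- The digits of `N` below the place `L` and the digits `p - 1` from there on, restricted to the
places congruent to `r` modulo `s`. -/
def classDigits (p L N : ℕ) {s : ℕ} (r : ZMod s) (i : ℕ) : ℕ :=
  if (i : ZMod s) = r then (if i < L then N / p ^ i % p else p - 1) else 0

theorem classDigits_le (hp : 2 ≤ p) (L N : ℕ) (r : ZMod s) (i : ℕ) :
    classDigits p L N r i ≤ p - 1 := by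
  have := Nat.mod_lt (N / p ^ i) (show p > 0 by omega)
  unfold classDigits
  split_ifs <;> omega

/-- The digits `p - 1` from place `L` on make every class infinite, so `place` never falls back on
the default value of `sInf`. -/
theorem exists_lt_sum_classDigits [NeZero s] (hp : 2 ≤ p) (L N : ℕ) (r : ZMod s) (n : ℕ) :
    ∃ i, n < ∑ k ∈ Finset.range (i + 1), classDigits p L N r k := by
  induction n with
  | zero =>
    refine ⟨r.val + s * L, Finset.sum_pos' (fun _ _ => Nat.zero_le _)
      ⟨r.val + s * L, by simp, ?_⟩⟩
    have hs := Nat.pos_of_ne_zero (NeZero.ne s)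
    have : L ≤ s * L := Nat.le_mul_of_pos_left _ hs
    rw [classDigits, if_pos (by simp), if_neg (by omega)]
    omega
  | succ n ih =>
    obtain ⟨i, hi⟩ := ih
    refine ⟨r.val + s * (L + i + 1), ?_⟩
    have hs := Nat.pos_of_ne_zero (NeZero.ne s)
    have : L + i + 1 ≤ s * (L + i + 1) := Nat.le_mul_of_pos_left _ hs
    rw [Finset.sum_range_succ, classDigits, if_pos (by simp), if_neg (by omega)]
    have h1 : ∑ k ∈ Finset.range (i + 1), classDigits p L N r k ≤
        ∑ k ∈ Finset.range (r.val + s * (L + i + 1)), classDigits p L N r k :=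
      Finset.sum_le_sum_of_subset (Finset.range_mono (by omega))
    omega

/-- The sizes of the atoms of `N` (continued by digits `p - 1`) in each class. -/
noncomputable def atomSize (p L N : ℕ) {s : ℕ} (r : ZMod s) (n : ℤ) : ℤ :=
  if n < 0 then 0 else (p : ℤ) ^ place (classDigits p L N r) n.toNat

theorem natCast_place_classDigits [NeZero s] (hp : 2 ≤ p) (L N : ℕ) (r : ZMod s) (n : ℕ) :
    (place (classDigits p L N r) n : ZMod s) = r := by
  by_contra h
  exact place_ne_zero (exists_lt_sum_classDigits hp L N r) n (if_neg h)

/-- Places of one class are congruent modulo `s`, so a later place is later by at least `s`; hence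
the factor `p ^ s` in `gap`. -/
theorem atomSizes_atomSize [NeZero s] (hp : 2 ≤ p) (L N : ℕ) :
    AtomSizes p s (atomSize p L N) := by
  have hp1 : (1 : ℤ) ≤ p := by exact_mod_cast (by omega : 1 ≤ p)
  refine ⟨fun r => ⟨fun n hn => if_pos hn, fun a b hab => ?_, fun n => ?_⟩, fun r n hn => ?_⟩
  · unfold atomSize
    split_ifs with h1 h2 h2
    · exact le_rfl
    · positivity
    · omega
    · exact pow_le_pow_right₀ hp1
        (place_mono (exists_lt_sum_classDigits hp L N r) (by omega))
  · unfold atomSize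
    split_ifs with h1 h2 h2
    · simp
    · simp only [mul_zero]; positivity
    · omega
    · rw [← pow_add]
      refine pow_le_pow_right₀ hp1 ?_
      have h3 := place_lt_place_add (exists_lt_sum_classDigits hp L N r)
        (classDigits_le hp L N r) n.toNat
      rw [show (n + ((p : ℤ) - 1)).toNat = n.toNat + (p - 1) by omega]
      have h4 : ((place (classDigits p L N r) (n.toNat + (p - 1)) -
          place (classDigits p L N r) n.toNat : ℕ) : ZMod s) = 0 := by
        rw [Nat.cast_sub h3.le, natCast_place_classDigits hp, natCast_place_classDigits hp,
          sub_self]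
      have h5 := Nat.le_of_dvd (by omega) ((ZMod.natCast_eq_zero_iff _ _).1 h4)
      omega
  · exact ⟨_, natCast_place_classDigits hp L N r n.toNat, by
      rw [atomSize, if_neg (by omega)]⟩

theorem cumul_atomSize (L N : ℕ) (r : ZMod s) (n : ℤ) :
    cumul (atomSize p L N r) n =
      ((∑ k ∈ Finset.range n.toNat, p ^ place (classDigits p L N r) k : ℕ) : ℤ) := by
  unfold cumul
  push_cast
  refine Finset.sum_congr rfl fun k _ => ?_
  rw [atomSize, if_neg (by omega)]
  simp

end

/-! ### From multiples of `p ^ s - 1` to integer vectors -/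

/-- As `p ^ s = 1` modulo `p ^ s - 1`, only the class of an atom matters for divisibility. -/
theorem pow_eq_pow_of_natCast_eq {p s : ℕ} (hp : 0 < p) {i j : ℕ} (h : (i : ZMod s) = j) :
    (p : ZMod (p ^ s - 1)) ^ i = (p : ZMod (p ^ s - 1)) ^ j := by
  have h1 : (p : ZMod (p ^ s - 1)) ^ s = 1 := by
    have h2 : ((p ^ s - 1 : ℕ) : ZMod (p ^ s - 1)) = 0 := ZMod.natCast_self _
    rw [Nat.cast_sub (Nat.one_le_pow _ _ hp)] at h2
    push_cast at h2
    exact sub_eq_zero.1 h2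
  rw [pow_eq_pow_mod i h1, pow_eq_pow_mod j h1, (ZMod.natCast_eq_natCast_iff' _ _ _).1 h]

/-- The numbers `∑ i < s, p ^ (s - 1 - i) c_{r - i}`, which are `p ^ s - 1` times the solution of
`cyclicDiff p d = c`. -/
def rotatedSum (p : ℕ) {s : ℕ} (c : ZMod s → ℕ) (r : ZMod s) : ℤ :=
  ∑ i ∈ Finset.range s, (p : ℤ) ^ (s - 1 - i) * c (r - i)

/-- The difference telescopes; after `s` steps the index is back at `r`, and the end terms are `p ^
s * c r` and `c r`. -/
theorem cyclicDiff_rotatedSum {p s : ℕ} (c : ZMod s → ℕ) (r : ZMod s) :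
    cyclicDiff p (rotatedSum p c) r = ((p : ℤ) ^ s - 1) * c r := by
  unfold cyclicDiff rotatedSum
  rw [Finset.mul_sum, ← Finset.sum_sub_distrib]
  have h : ∀ i ∈ Finset.range s, (p : ℤ) * ((p : ℤ) ^ (s - 1 - i) * (c (r - i) : ℤ)) -
      (p : ℤ) ^ (s - 1 - i) * (c (r - 1 - i) : ℤ) =
      (p : ℤ) ^ (s - i) * (c (r - (i : ℕ)) : ℤ) -
        (p : ℤ) ^ (s - (i + 1)) * (c (r - ((i + 1 : ℕ) : ZMod s)) : ℤ) := by
    intro i hi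
    have := Finset.mem_range.1 hi
    rw [show s - i = s - 1 - i + 1 by omega, show s - (i + 1) = s - 1 - i by omega, pow_succ',
      show r - ((i + 1 : ℕ) : ZMod s) = r - 1 - i by push_cast; ring]
    ring
  rw [Finset.sum_congr rfl h,
    Finset.sum_range_sub' fun i : ℕ => (p : ℤ) ^ (s - i) * (c (r - (i : ℕ)) : ℤ)]
  simp
  ring

section

variable {p s : ℕ} [NeZero s]

theorem sum_range_sub_natCast {M : Type*} [AddCommMonoid M] (f : ZMod s → M) (r : ZMod s) :
    ∑ i ∈ Finset.range s, f (r - i) = ∑ u, f u := by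
  refine Finset.sum_nbij' (fun i => r - (i : ZMod s)) (fun u => (r - u).val) ?_ ?_ ?_ ?_ ?_
  · intro a _; simp
  · intro a _; simpa using ZMod.val_lt _
  · intro a ha
    have := ZMod.val_cast_of_lt (Finset.mem_range.1 ha)
    simpa using this
  · intro a _; simp
  · intro a _; rfl

theorem sum_classDigitSum_mul {M : Type*} [CommSemiring M] (p L Y : ℕ) (f : ZMod s → M) :
    ∑ r : ZMod s, (classDigitSum p L Y r : M) * f r =
      ∑ i ∈ Finset.range L, ((Y / p ^ i % p : ℕ) : M) * f i := by
  simp only [classDigitSum, Nat.cast_sum, Finset.sum_mul]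
  rw [Finset.sum_comm]
  refine Finset.sum_congr rfl fun i _ => ?_
  rw [Finset.sum_eq_single (i : ZMod s)]
  · simp
  · intro r _ hr
    rw [if_neg hr.symm]
    simp
  · simp

theorem natCast_eq_sum_classDigitSum (hp : 0 < p) {L Y : ℕ} (hY : Y < p ^ L) :
    (Y : ZMod (p ^ s - 1)) =
      ∑ r : ZMod s, (classDigitSum p L Y r : ZMod (p ^ s - 1)) * (p : ZMod (p ^ s - 1)) ^ r.val := by
  rw [sum_classDigitSum_mul p L Y fun r : ZMod s => (p : ZMod (p ^ s - 1)) ^ r.val]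
  conv_lhs => rw [← sum_digits_mul_pow p hY]
  push_cast
  refine Finset.sum_congr rfl fun i _ => ?_
  rw [pow_eq_pow_of_natCast_eq (s := s) hp (j := ((i : ℕ) : ZMod s).val) (by simp)]

/-- Modulo `p ^ s - 1`, the rotated sum at `r` times the unit `p ^ (r.val + 1)` is `x`. -/
theorem dvd_rotatedSum (hp : 0 < p) {L x : ℕ} (hx : x < p ^ L) (hdvd : p ^ s - 1 ∣ x)
    (r : ZMod s) : ((p : ℤ) ^ s - 1) ∣ rotatedSum p (classDigitSum p L x) r := by
  have hcast : ((p : ℤ) ^ s - 1) = ((p ^ s - 1 : ℕ) : ℤ) := by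
    rw [Nat.cast_sub (Nat.one_le_pow _ _ hp)]
    push_cast
    rfl
  rw [hcast, ← ZMod.intCast_zmod_eq_zero_iff_dvd]
  have hunit : IsUnit ((p : ZMod (p ^ s - 1)) ^ (r.val + 1)) := by
    refine IsUnit.pow _ (IsUnit.of_mul_eq_one ((p : ZMod (p ^ s - 1)) ^ (s - 1)) ?_)
    rw [← pow_succ', Nat.sub_add_cancel (Nat.pos_of_ne_zero (NeZero.ne s)),
      pow_eq_pow_of_natCast_eq (s := s) hp (j := 0) (by simp), pow_zero]
  refine (hunit.mul_left_eq_zero).1 ?_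
  have h1 := natCast_eq_sum_classDigitSum (s := s) hp hx
  rw [(ZMod.natCast_eq_zero_iff _ _).2 hdvd, ← sum_range_sub_natCast _ r] at h1
  rw [h1, rotatedSum]
  push_cast
  rw [Finset.sum_mul]
  refine Finset.sum_congr rfl fun i hi => ?_
  have hi' := Finset.mem_range.1 hi
  have h2 : (p : ZMod (p ^ s - 1)) ^ (s - 1 - i) * (p : ZMod (p ^ s - 1)) ^ (r.val + 1) =
      (p : ZMod (p ^ s - 1)) ^ (r - (i : ZMod s)).val := by
    rw [← pow_add]
    refine pow_eq_pow_of_natCast_eq hp ?_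
    rw [ZMod.natCast_zmod_val, Nat.cast_add, Nat.cast_add, Nat.cast_sub (by omega),
      Nat.cast_sub (by omega)]
    simp
    ring
  rw [← h2]
  ring

/-- The solution `d` of `cyclicDiff p d = classDigitSum p L x`. -/
def digitVector (p L : ℕ) (x : ℕ) (r : ZMod s) : ℤ :=
  rotatedSum p (classDigitSum p L x) r / ((p : ℤ) ^ s - 1)

theorem mul_digitVector (hp : 0 < p) {L x : ℕ} (hx : x < p ^ L) (hdvd : p ^ s - 1 ∣ x)
    (r : ZMod s) :
    ((p : ℤ) ^ s - 1) * digitVector p L x r = rotatedSum p (classDigitSum p L x) r :=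
  Int.mul_ediv_cancel' (dvd_rotatedSum hp hx hdvd r)

theorem cyclicDiff_digitVector (hp : 2 ≤ p) {L x : ℕ} (hx : x < p ^ L) (hdvd : p ^ s - 1 ∣ x)
    (r : ZMod s) : cyclicDiff p (digitVector p L x) r = classDigitSum p L x r := by
  have hq : (1 : ℤ) < (p : ℤ) ^ s := one_lt_pow₀ (by exact_mod_cast hp) (NeZero.ne s)
  have h1 := cyclicDiff_rotatedSum (p := p) (classDigitSum p L x) r
  have h2 := mul_digitVector (by omega) hx hdvd r
  have h3 := mul_digitVector (by omega) hx hdvd (r - 1)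
  have h4 : ((p : ℤ) ^ s - 1) * cyclicDiff p (digitVector p L x) r =
      ((p : ℤ) ^ s - 1) * classDigitSum p L x r := by
    rw [← h1]
    unfold cyclicDiff
    rw [← h2, ← h3]
    ring
  exact mul_left_cancel₀ (by linarith) h4

/-- Every coordinate involves all classes with positive coefficients. This is why chains increase in
each coordinate. -/
theorem rotatedSum_pos (hp : 2 ≤ p) {L x : ℕ} (hx : x < p ^ L) (hx0 : 0 < x) (r : ZMod s) :
    0 < rotatedSum p (classDigitSum p L x) r := by
  have h1 : ∃ u : ZMod s, classDigitSum p L x u ≠ 0 := by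
    by_contra hall
    push Not at hall
    have h2 := sum_classDigitSum_mul (s := s) (M := ℕ) p L x fun _ => 1
    simp only [hall, Nat.cast_id, mul_one, Finset.sum_const_zero] at h2
    have h3 := sum_digits_mul_pow p hx
    rw [Finset.sum_eq_zero fun i hi => by
      rw [(Finset.sum_eq_zero_iff.1 h2.symm) i hi, zero_mul]] at h3
    omega
  obtain ⟨u, hu⟩ := h1
  have hp0 : (0 : ℤ) < p := by exact_mod_cast (by omega : 0 < p)
  refine Finset.sum_pos' (fun i _ => by positivity)
    ⟨(r - u).val, by simpa using ZMod.val_lt _, ?_⟩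
  have : r - (((r - u).val : ℕ) : ZMod s) = u := by simp
  rw [this]
  have := Nat.pos_of_ne_zero hu
  positivity

/-- `Y` uses as many atoms of `N` in each class as `cost` counts, and `cost` takes the smallest
ones. -/
theorem cost_digitVector_le (hp : 2 ≤ p) {L N Y : ℕ} (hYL : Y < p ^ L)
    (hdvd : p ^ s - 1 ∣ Y) (hYN : ∀ i, Y / p ^ i % p ≤ N / p ^ i % p) :
    cost p (atomSize p L N) (digitVector (s := s) p L Y) ≤ Y := by
  have h1 : ∀ r : ZMod s, cumul (atomSize p L N r) (cyclicDiff p (digitVector p L Y) r) ≤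
      ((∑ i ∈ Finset.range L, (if (i : ZMod s) = r then Y / p ^ i % p else 0) * p ^ i : ℕ) : ℤ) := by
    intro r
    rw [cyclicDiff_digitVector hp hYL hdvd, cumul_atomSize, Int.toNat_natCast]
    have hcut : ∀ (f : ℕ → ℕ), ∑ i ∈ Finset.range L, (if i < L then f i else 0) =
        ∑ i ∈ Finset.range L, f i := fun f =>
      Finset.sum_congr rfl fun i hi => if_pos (Finset.mem_range.1 hi)
    have h2 := sum_place_le_sum (b := classDigits p L N r) (P := fun i => p ^ i)
      (y := fun i => if i < L then (if (i : ZMod s) = r then Y / p ^ i % p else 0) else 0)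
      (fun a b hab => Nat.pow_le_pow_right (by omega) hab)
      (fun i => by
        have := hYN i
        unfold classDigits
        split_ifs <;> omega) L
    rw [hcut] at h2
    simp only [ite_mul, zero_mul] at h2
    rw [hcut fun i => if (i : ZMod s) = r then Y / p ^ i % p * p ^ i else 0] at h2
    simp only [ite_mul, zero_mul]
    exact_mod_cast h2
  refine (Finset.sum_le_sum fun r _ => h1 r).trans_eq ?_
  rw [← Nat.cast_sum, Finset.sum_comm]
  conv_rhs => rw [← sum_digits_mul_pow p hYL]
  congr 1
  refine Finset.sum_congr rfl fun i _ => ?_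
  rw [Finset.sum_eq_single (i : ZMod s)]
  · simp
  · intro r _ hr
    rw [if_neg hr.symm, zero_mul]
  · simp

end

/-! ### Partial sums of a tuple as a chain -/

/-- The sum of the entries of a tuple with index below `l`. -/
def partialSum {m : ℕ} (X : Fin m → ℕ) (l : ℕ) : ℕ :=
  ∑ j ∈ Finset.univ.filter fun j : Fin m => (j : ℕ) < l, X j

section

variable {p s k N L : ℕ} {X : Fin (k + 1) → ℕ}

theorem partialSum_zero {m : ℕ} (X : Fin m → ℕ) : partialSum X 0 = 0 := by simp [partialSum]

theorem partialSum_succ {m : ℕ} (X : Fin m → ℕ) {l : ℕ} (hl : l < m) :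
    partialSum X (l + 1) = partialSum X l + X ⟨l, hl⟩ := by
  unfold partialSum
  have : (Finset.univ.filter fun j : Fin m => (j : ℕ) < l + 1) =
      insert ⟨l, hl⟩ (Finset.univ.filter fun j : Fin m => (j : ℕ) < l) := by
    ext j
    simp [Fin.ext_iff]
    omega
  rw [this, Finset.sum_insert (by simp), add_comm]

theorem partialSum_le {m : ℕ} (X : Fin m → ℕ) (l : ℕ) : partialSum X l ≤ ∑ j, X j :=
  Finset.sum_le_sum_of_subset (Finset.filter_subset _ _)

theorem partialSum_of_le {m : ℕ} (X : Fin m → ℕ) {l : ℕ} (hl : m ≤ l) :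
    partialSum X l = ∑ j, X j := by
  unfold partialSum
  rw [Finset.filter_true_of_mem]
  intro j _
  have := j.isLt
  omega

theorem partialSum_congr {m l l' : ℕ} {X X' : Fin m → ℕ} (hsum : ∑ j, X j = ∑ j, X' j)
    (h : ∀ j : Fin m, l ≤ (j : ℕ) → X j = X' j) (hl : l ≤ l') :
    partialSum X l' = partialSum X' l' := by
  unfold partialSum
  have h1 := Finset.sum_filter_add_sum_filter_not Finset.univ (fun j : Fin m => (j : ℕ) < l') X
  have h2 := Finset.sum_filter_add_sum_filter_not Finset.univ (fun j : Fin m => (j : ℕ) < l') X'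
  have h3 : ∑ j ∈ Finset.univ.filter (fun j : Fin m => ¬ (j : ℕ) < l'), X j =
      ∑ j ∈ Finset.univ.filter (fun j : Fin m => ¬ (j : ℕ) < l'), X' j :=
    Finset.sum_congr rfl fun j hj => h j (by
      have := (Finset.mem_filter.1 hj).2
      omega)
  omega

/-- `X j` occurs in `k - j` of the partial sums and has weight `j + 1`. So maximal weight means
minimal total of the partial sums. -/
theorem sum_partialSum_add_tupleWeight (X : Fin (k + 1) → ℕ) :
    ∑ l ∈ Finset.range (k + 1), partialSum X l + tupleWeight X = (k + 1) * ∑ j, X j := by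
  unfold partialSum tupleWeight
  simp only [Finset.sum_filter]
  rw [Finset.sum_comm, ← Finset.sum_add_distrib, Finset.mul_sum]
  refine Finset.sum_congr rfl fun j _ => ?_
  rw [← Finset.sum_filter, Finset.sum_const, smul_eq_mul, ← add_mul]
  congr 1
  have : ((Finset.range (k + 1)).filter fun l => (j : ℕ) < l) = Finset.Ico ((j : ℕ) + 1) (k + 1) := by
    ext l
    simp
    omega
  rw [this, Nat.card_Ico]
  have := j.isLt
  omega

theorem digit_partialSum {m : ℕ} {X : Fin m → ℕ} (hX : NoCarry p X) (l i : ℕ) :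
    partialSum X l / p ^ i % p =
      ∑ j ∈ Finset.univ.filter fun j : Fin m => (j : ℕ) < l, X j / p ^ i % p :=
  sum_div_pow_mod_of_no_carry _ X (fun i =>
    (Finset.sum_le_sum_of_subset (Finset.filter_subset _ _)).trans_lt (hX i)) i

theorem digit_partialSum_le (hX : X ∈ tuplesU p s (k + 1) N) (l i : ℕ) :
    partialSum X l / p ^ i % p ≤ N / p ^ i % p := by
  obtain ⟨h1, h2, -⟩ := hX
  rw [digit_partialSum h2, ← h1, sum_div_pow_mod_of_no_carry _ X h2]
  exact Finset.sum_le_sum_of_subset (Finset.filter_subset _ _)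

theorem digit_partialSum_succ {m : ℕ} {X : Fin m → ℕ} (hX : NoCarry p X) {l : ℕ} (hl : l < m)
    (i : ℕ) : partialSum X (l + 1) / p ^ i % p =
      partialSum X l / p ^ i % p + X ⟨l, hl⟩ / p ^ i % p := by
  rw [digit_partialSum hX, digit_partialSum hX]
  exact partialSum_succ (fun j => X j / p ^ i % p) hl

theorem dvd_partialSum (hX : X ∈ tuplesU p s (k + 1) N) {l : ℕ} (hl : l ≤ k) :
    p ^ s - 1 ∣ partialSum X l := by
  refine Finset.dvd_sum fun j hj => (hX.2.2 j ?_).2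
  have := (Finset.mem_filter.1 hj).2
  omega

theorem partialSum_lt (hNL : N < p ^ L) (hX : X ∈ tuplesU p s (k + 1) N) (l : ℕ) :
    partialSum X l < p ^ L :=
  ((partialSum_le X l).trans_eq hX.1).trans_lt hNL

variable [NeZero s]

/-- The chain of vectors belonging to a tuple. -/
theorem boxedChain_of_tuple (hp : 2 ≤ p) (hNL : N < p ^ L) (hX : X ∈ tuplesU p s (k + 1) N)
    {t : ZMod s → ℤ} (ht : ∀ r, digitVector p L (partialSum X k) r ≤ t r) :
    BoxedChain p (fun r => (classDigitSum p L N r : ℤ)) t k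
      (fun l => digitVector p L (partialSum X l)) := by
  have hq : (1 : ℤ) < (p : ℤ) ^ s := one_lt_pow₀ (by exact_mod_cast hp) (NeZero.ne s)
  have hstep : ∀ j < k, ∀ r : ZMod s, digitVector p L (partialSum X j) r + 1 ≤
      digitVector p L (partialSum X (j + 1)) r := by
    intro j hj r
    have hXj := hX.2.2 ⟨j, by omega⟩ (by simpa using hj)
    have hXlt : X ⟨j, by omega⟩ < p ^ L :=
      ((Finset.single_le_sum (fun _ _ => Nat.zero_le _) (Finset.mem_univ _)).trans_eq
        hX.1).trans_lt hNL
    have h1 := mul_digitVector (s := s) (by omega) (partialSum_lt hNL hX j)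
      (dvd_partialSum hX hj.le) r
    have h2 := mul_digitVector (s := s) (by omega) (partialSum_lt hNL hX (j + 1))
      (dvd_partialSum hX hj) r
    have h3 := mul_digitVector (s := s) (by omega) hXlt hXj.2 r
    have h4 := rotatedSum_pos (s := s) hp hXlt hXj.1 r
    -- Without carries, digits and hence rotated sums are additive.
    have h5 : rotatedSum p (classDigitSum p L (partialSum X (j + 1))) r =
        rotatedSum p (classDigitSum p L (partialSum X j)) r +
          rotatedSum p (classDigitSum p L (X ⟨j, by omega⟩)) r := by
      unfold rotatedSum
      rw [← Finset.sum_add_distrib]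
      refine Finset.sum_congr rfl fun i _ => ?_
      rw [← mul_add, ← Nat.cast_add]
      congr 2
      unfold classDigitSum
      rw [← Finset.sum_add_distrib]
      refine Finset.sum_congr rfl fun i _ => ?_
      split_ifs
      · exact digit_partialSum_succ hX.2.1 (by omega) i
      · rfl
    rw [← h1, ← h2, ← h3] at h5
    rw [← h3] at h4
    have h6 : 0 < digitVector p L (X ⟨j, by omega⟩) r := pos_of_mul_pos_right h4 (by linarith)
    rw [← mul_add] at h5
    have h7 := mul_left_cancel₀ (by linarith) h5
    omega
  refine ⟨?_, hstep, ?_, ?_⟩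
  · funext r
    simp [partialSum_zero, digitVector, rotatedSum, classDigitSum]
  · intro j hj r
    rw [cyclicDiff_digitVector hp (partialSum_lt hNL hX j) (dvd_partialSum hX hj)]
    refine Nat.cast_le.2 (Finset.sum_le_sum fun i _ => ?_)
    split_ifs
    · exact digit_partialSum_le hX j i
    · exact le_rfl
  · intro j hj r
    refine le_trans ?_ (ht r)
    induction hj using Nat.decreasingInduction with
    | self => exact le_rfl
    | of_succ j hj ih => linarith [hstep j hj r]

theorem cost_digitVector_partialSum_le (hp : 2 ≤ p) (hNL : N < p ^ L)
    (hX : X ∈ tuplesU p s (k + 1) N) {l : ℕ} (hl : l ≤ k) :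
    cost p (atomSize p L N) (digitVector (s := s) p L (partialSum X l)) ≤ partialSum X l :=
  cost_digitVector_le hp (partialSum_lt hNL hX l) (dvd_partialSum hX hl) (digit_partialSum_le hX l)

end

/-! ### From nested chains back to tuples -/

theorem sum_classDigits {p s N L : ℕ} (r : ZMod s) :
    ∑ i ∈ Finset.range L, classDigits p L N r i = classDigitSum p L N r :=
  Finset.sum_congr rfl fun i hi => by rw [classDigits, if_pos (Finset.mem_range.1 hi)]

section

variable {p s k N L : ℕ} [NeZero s]

/-- The `i`-th digit of the number which consists of the `c r` smallest atoms of `N` in each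
class `r`. -/
noncomputable def prefixDigit (p L N : ℕ) {s : ℕ} (c : ZMod s → ℤ) (i : ℕ) : ℕ :=
  placeCount (classDigits p L N (i : ZMod s)) (c i).toNat i

theorem cost_eq_sum_prefixDigit (hp : 2 ≤ p) {d : ZMod s → ℤ}
    (hd : ∀ r, cyclicDiff p d r ≤ classDigitSum p L N r) :
    cost p (atomSize p L N) d =
      ((∑ i ∈ Finset.range L, prefixDigit p L N (cyclicDiff p d) i * p ^ i : ℕ) : ℤ) := by
  unfold cost
  simp only [cumul_atomSize]
  rw [← Nat.cast_sum]
  congr 1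
  have h1 : ∀ r : ZMod s, ∑ k ∈ Finset.range (cyclicDiff p d r).toNat,
      p ^ place (classDigits p L N r) k = ∑ i ∈ Finset.range L,
        placeCount (classDigits p L N r) (cyclicDiff p d r).toNat i * p ^ i := fun r =>
    sum_place_eq (by
      rw [sum_classDigits]
      have := hd r
      omega) (fun i => p ^ i)
  rw [Finset.sum_congr rfl fun r _ => h1 r, Finset.sum_comm]
  refine Finset.sum_congr rfl fun i _ => ?_
  rw [Finset.sum_eq_single (i : ZMod s)]
  · rfl
  · intro r _ hr
    have := placeCount_le (exists_lt_sum_classDigits hp L N r) (cyclicDiff p d r).toNat i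
    rw [classDigits, if_neg hr.symm] at this
    rw [Nat.le_zero.1 this, zero_mul]
  · simp

theorem prefixDigit_le (hp : 2 ≤ p) (c : ZMod s → ℤ) {i : ℕ} (hi : i < L) :
    prefixDigit p L N c i ≤ N / p ^ i % p := by
  have := placeCount_le (exists_lt_sum_classDigits hp L N (i : ZMod s)) (c i).toNat i
  rwa [classDigits, if_pos rfl, if_pos hi] at this

/-- Modulo `p ^ s - 1` an atom of class `r` is `p ^ r.val`, and `∑ r, (p * d r - d (r - 1)) * p ^
r.val` cancels after a cyclic shift. -/
theorem dvd_sum_prefixDigit (hp : 2 ≤ p) {d : ZMod s → ℤ} (h0 : ∀ r, 0 ≤ cyclicDiff p d r)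
    (hd : ∀ r, cyclicDiff p d r ≤ classDigitSum p L N r) :
    p ^ s - 1 ∣ ∑ i ∈ Finset.range L, prefixDigit p L N (cyclicDiff p d) i * p ^ i := by
  have h1 := cost_eq_sum_prefixDigit hp hd
  rw [← ZMod.natCast_eq_zero_iff, ← Int.cast_natCast, ← h1]
  unfold cost
  push_cast
  have h2 : ∀ r : ZMod s, ((cumul (atomSize p L N r) (cyclicDiff p d r) : ℤ) : ZMod (p ^ s - 1)) =
      (cyclicDiff p d r : ZMod (p ^ s - 1)) * (p : ZMod (p ^ s - 1)) ^ r.val := by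
    intro r
    rw [cumul_atomSize]
    push_cast
    rw [Finset.sum_congr rfl fun k _ => pow_eq_pow_of_natCast_eq (s := s) (by omega)
      (j := r.val) (by rw [natCast_place_classDigits hp]; simp), Finset.sum_const,
      Finset.card_range, nsmul_eq_mul]
    congr 1
    rw [← Int.cast_natCast, Int.toNat_of_nonneg (h0 r)]
  rw [Finset.sum_congr rfl fun r _ => h2 r]
  have h3 : ∀ r : ZMod s, (cyclicDiff p d r : ZMod (p ^ s - 1)) * (p : ZMod (p ^ s - 1)) ^ r.val =
      d r * (p : ZMod (p ^ s - 1)) ^ (r + 1).val -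
        d (r - 1) * (p : ZMod (p ^ s - 1)) ^ (r - 1 + 1).val := by
    intro r
    rw [pow_eq_pow_of_natCast_eq (s := s) (by omega) (i := (r + 1).val) (j := r.val + 1) (by simp),
      sub_add_cancel, cyclicDiff]
    push_cast
    ring
  rw [Finset.sum_congr rfl fun r _ => h3 r, Finset.sum_sub_distrib, sub_eq_zero]
  exact (Fintype.sum_equiv (Equiv.subRight (1 : ZMod s)) _
    (fun r => (d r : ZMod (p ^ s - 1)) * (p : ZMod (p ^ s - 1)) ^ (r + 1).val)
    (fun r => by simp)).symm

/-- Summed over the classes, `cyclicDiff` gives `(p - 1) * ∑ r, d r`, so some class gains an atom.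
This makes the entries of the tuple positive. -/
theorem cost_lt_cost {g : ZMod s → ℤ → ℤ} (hg : AtomSizes p s g) (hp : 2 ≤ p) {d d' : ZMod s → ℤ}
    (h0 : ∀ r, 0 ≤ cyclicDiff p d r) (hdd : ∀ r, d r < d' r)
    (hle : ∀ r, cyclicDiff p d r ≤ cyclicDiff p d' r) : cost p g d < cost p g d' := by
  refine Finset.sum_lt_sum (fun r _ => (hg.growing r).cumul_mono (hle r)) ?_
  have hsum : ∀ d : ZMod s → ℤ, ∑ r, cyclicDiff p d r = ((p : ℤ) - 1) * ∑ r, d r := by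
    intro d
    unfold cyclicDiff
    rw [Finset.sum_sub_distrib, ← Finset.mul_sum, Fintype.sum_equiv (Equiv.subRight (1 : ZMod s))
      (fun r => d (r - 1)) d (fun r => rfl)]
    ring
  have hlt : ∑ r, cyclicDiff p d r < ∑ r, cyclicDiff p d' r := by
    rw [hsum, hsum]
    have hp1 : (2 : ℤ) ≤ p := by exact_mod_cast hp
    exact mul_lt_mul_of_pos_left (Finset.sum_lt_sum_of_nonempty Finset.univ_nonempty
      fun r _ => hdd r) (by linarith)
  obtain ⟨r, hr, hr'⟩ := Finset.exists_lt_of_sum_lt hlt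
  refine ⟨r, hr, ?_⟩
  have h1 := (hg.growing r).cumul_mono (show cyclicDiff p d r + 1 ≤ cyclicDiff p d' r by omega)
  rw [(hg.growing r).cumul_succ] at h1
  linarith [hg.pos (r := r) hp (h0 r)]

/-- A nested chain comes from a tuple. -/
theorem exists_tuple_of_chain (hp : 2 ≤ p) (hNL : N < p ^ L) {t : ZMod s → ℤ}
    {Z : ℕ → ZMod s → ℤ} (hZ : BoxedChain p (fun r => (classDigitSum p L N r : ℤ)) t k Z)
    (hnest : ∀ j < k, ∀ r, cyclicDiff p (Z j) r ≤ cyclicDiff p (Z (j + 1)) r) :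
    ∃ X ∈ tuplesU p s (k + 1) N,
      ((∑ l ∈ Finset.range (k + 1), partialSum X l : ℕ) : ℤ) =
        chainCost p (atomSize p L N) k Z := by
  have hg := atomSizes_atomSize (s := s) hp L N
  have hnn : ∀ j ≤ k, ∀ r, 0 ≤ cyclicDiff p (Z j) r := by
    intro j
    induction j with
    | zero => intro _ r; simp [hZ.zero, cyclicDiff]
    | succ j ih => intro hj r; exact (ih (by omega) r).trans (hnest j (by omega) r)
  -- Digits of the future partial sums: the smallest atoms for `l ≤ k`, and all of `N` beyond.
  set y : ℕ → ℕ → ℕ := fun l i => if i < L then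
    (if l ≤ k then prefixDigit p L N (cyclicDiff p (Z l)) i else N / p ^ i % p) else 0 with hy
  have hyle : ∀ l i, y l i ≤ N / p ^ i % p := by
    intro l i
    simp only [hy]
    split_ifs with h1 h2
    · exact prefixDigit_le hp _ h1
    · exact le_rfl
    · exact Nat.zero_le _
  have hymono : ∀ i, Monotone fun l => y l i := by
    intro i
    refine monotone_nat_of_le_succ fun l => ?_
    by_cases hl : l + 1 ≤ k
    · simp only [hy, if_pos hl, if_pos (show l ≤ k by omega)]
      split_ifs
      · exact placeCount_mono (Int.toNat_le_toNat (hnest l hl _)) i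
      · exact le_rfl
    · have h1 := hyle l i
      simp only [hy, if_neg hl] at h1 ⊢
      split_ifs at h1 ⊢ <;> omega
  set Y : ℕ → ℕ := fun l => ∑ i ∈ Finset.range L, y l i * p ^ i with hY
  have hYmono : Monotone Y := fun a b hab =>
    Finset.sum_le_sum fun i _ => Nat.mul_le_mul_right _ (hymono i hab)
  have hYeq : ∀ l ≤ k, Y l = ∑ i ∈ Finset.range L,
      prefixDigit p L N (cyclicDiff p (Z l)) i * p ^ i := fun l hl =>
    Finset.sum_congr rfl fun i hi => by
      simp only [hy, if_pos hl, if_pos (Finset.mem_range.1 hi)]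
  have hYcost : ∀ l ≤ k, (Y l : ℤ) = cost p (atomSize p L N) (Z l) := fun l hl => by
    rw [hYeq l hl, cost_eq_sum_prefixDigit hp (hZ.le_box l hl)]
  have hY0 : Y 0 = 0 := by
    have := hYcost 0 (Nat.zero_le k)
    have h2 : cost p (atomSize p L N) (Z 0) = 0 := by
      simp [cost, cyclicDiff, hZ.zero, cumul]
    rw [h2] at this
    exact_mod_cast this
  have hYtop : Y (k + 1) = N := by
    rw [← sum_digits_mul_pow p hNL]
    exact Finset.sum_congr rfl fun i hi => by
      simp only [hy, if_neg (show ¬ k + 1 ≤ k by omega), if_pos (Finset.mem_range.1 hi)]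
  have hpart : ∀ l ≤ k + 1, partialSum (fun j : Fin (k + 1) => Y (j + 1) - Y j) l = Y l := by
    intro l
    induction l with
    | zero => intro _; rw [partialSum_zero, hY0]
    | succ l ih =>
      intro hl
      rw [partialSum_succ _ (by omega), ih (by omega)]
      have := hYmono (Nat.le_succ l)
      simp only [Nat.succ_eq_add_one] at this ⊢
      omega
  refine ⟨fun j => Y (j + 1) - Y j, ⟨?_, ?_, ?_⟩, ?_⟩
  · rw [← partialSum_of_le _ le_rfl, hpart _ le_rfl, hYtop]
  · have hpp : 0 < p := by omega
    -- The digits increase with `l`, so subtraction needs no borrow and the digits of the entries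
    -- telescope to at most a digit of `N`.
    have hdig : ∀ (j : Fin (k + 1)) i, (Y (j + 1) - Y j) / p ^ i % p = y (j + 1) i - y j i := by
      intro j i
      have h1 : Y (j + 1) - Y j = ∑ i ∈ Finset.range L, (y (j + 1) i - y j i) * p ^ i := by
        rw [Nat.sub_eq_iff_eq_add (hYmono (Nat.le_succ _)), ← Finset.sum_add_distrib]
        refine Finset.sum_congr rfl fun i _ => ?_
        rw [← add_mul, Nat.sub_add_cancel (hymono i (Nat.le_succ _))]
      rw [h1, sum_mul_pow_div_pow_mod L fun i => ?_]
      · split_ifs with h2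
        · rfl
        · simp [hy, h2]
      · have h2 := hyle (j + 1) i
        have h3 := Nat.mod_lt (N / p ^ i) hpp
        omega
    intro i
    simp only [hdig]
    rw [Fin.sum_univ_eq_sum_range fun j => y (j + 1) i - y j i,
      Finset.sum_range_tsub (hymono i)]
    exact ((Nat.sub_le _ _).trans (hyle _ i)).trans_lt (Nat.mod_lt _ hpp)
  · intro j hj
    have hj' : (j : ℕ) < k := by omega
    have hlt : Y j < Y (j + 1) := by
      have := cost_lt_cost hg hp (hnn j hj'.le)
        (fun r => by linarith [hZ.step j hj' r]) (hnest j hj')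
      rw [← hYcost j hj'.le, ← hYcost (j + 1) hj'] at this
      exact_mod_cast this
    refine ⟨by simpa using hlt, Nat.dvd_sub ?_ ?_⟩
    · rw [hYeq _ hj']
      exact dvd_sum_prefixDigit hp (hnn _ hj') (hZ.le_box _ hj')
    · rw [hYeq _ hj'.le]
      exact dvd_sum_prefixDigit hp (hnn _ hj'.le) (hZ.le_box _ hj'.le)
  · rw [Nat.cast_sum]
    refine Finset.sum_congr rfl fun l hl => ?_
    have hl' := Finset.mem_range.1 hl
    rw [hpart l hl'.le, hYcost l (by omega)]

end

/-! ### Maximal weight and greediness -/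

/-- A tuple of maximal weight is greedy. -/
theorem isGreedy_of_tupleWeight_le {p s k N : ℕ} (hp : 2 ≤ p) (hs : s ≠ 0)
    {X : Fin (k + 1) → ℕ} (hX : X ∈ tuplesU p s (k + 1) N)
    (hmax : ∀ X' ∈ tuplesU p s (k + 1) N, tupleWeight X' ≤ tupleWeight X) :
    IsGreedy (tuplesU p s (k + 1) N) X := by
  have : NeZero s := ⟨hs⟩
  refine ⟨hX, fun X' hX' => ?_⟩
  by_contra hlt
  obtain ⟨i, hi1, hi2⟩ := not_le.1 hlt
  set l : ℕ := (Fin.rev i : ℕ) with hl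
  have hlk : l ≤ k := by omega
  have hagree : ∀ j : Fin (k + 1), l + 1 ≤ (j : ℕ) → X j = X' j := by
    intro j hj
    have := hi1 (Fin.rev j) (by
      change Fin.rev j < i
      rw [Fin.lt_def, Fin.val_rev]
      rw [Fin.val_rev] at hl
      omega)
    simpa using this
  have hNL : N < p ^ N := Nat.lt_pow_self (by omega)
  have hg := atomSizes_atomSize (s := s) hp N N
  have hsumX := hX.1.trans hX'.1.symm
  -- A common cap for the chains of both tuples.
  set t : ZMod s → ℤ := digitVector p N (partialSum X k) ⊔ digitVector p N (partialSum X' k)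
  have hD := boxedChain_of_tuple (t := t) hp hNL hX (fun r => le_max_left _ _)
  have hD' := boxedChain_of_tuple (t := t) hp hNL hX' (fun r => le_max_right _ _)
  -- The relaxed minimum is attained by a tuple `W`, whose weight does not exceed that of `X`. So
  -- the chain of `X` is optimal and each of its partial sums equals its cost.
  obtain ⟨Z, hZ, hZnest, hZmin⟩ := exists_nested_chain hg hp (fun r => Nat.cast_nonneg _) hD
  obtain ⟨W, hW, hWcost⟩ := exists_tuple_of_chain hp hNL hZ hZnest
  have hWX : ∑ l ∈ Finset.range (k + 1), partialSum X l ≤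
      ∑ l ∈ Finset.range (k + 1), partialSum W l := by
    have h1 := hmax W hW
    have h2 := sum_partialSum_add_tupleWeight X
    have h3 := sum_partialSum_add_tupleWeight W
    rw [hX.1] at h2
    rw [hW.1] at h3
    omega
  have hcostle : ∀ j ∈ Finset.range (k + 1), cost p (atomSize p N N)
      (digitVector (s := s) p N (partialSum X j)) ≤ (partialSum X j : ℤ) := fun j hj =>
    cost_digitVector_partialSum_le hp hNL hX (Nat.lt_succ_iff.1 (Finset.mem_range.1 hj))
  have hcost := Finset.sum_le_sum hcostle
  have hWX' : ((∑ l ∈ Finset.range (k + 1), partialSum X l : ℕ) : ℤ) ≤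
      chainCost p (atomSize p N N) k Z := by
    rw [← hWcost]
    exact_mod_cast hWX
  rw [Nat.cast_sum] at hWX'
  have hopt : IsOptimalChain p (atomSize p N N) (fun r : ZMod s => (classDigitSum p N N r : ℤ)) t k
      (fun l => digitVector p N (partialSum X l)) :=
    ⟨hD, fun f hf => (hcost.trans hWX').trans (hZmin f hf)⟩
  have hcosteq : cost p (atomSize p N N) (digitVector (s := s) p N (partialSum X l)) =
      (partialSum X l : ℤ) := by
    have h1 := hZmin _ hD
    have h2 : ∑ j ∈ Finset.range (k + 1), cost p (atomSize p N N)
      (digitVector (s := s) p N (partialSum X j)) =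
        ∑ j ∈ Finset.range (k + 1), (partialSum X j : ℤ) :=
      le_antisymm hcost (hWX'.trans h1)
    exact (Finset.sum_eq_sum_iff_of_le hcostle).1 h2 l (by simp; omega)
  -- The tuples agree above `l`, so the vector of `X'` at `l` fits under the rest of the chain of
  -- `X` and cannot be cheaper than that of `X`.
  have hle := hopt.cost_le (e := digitVector p N (partialSum X' l)) hg hp hlk
    (fun r => hD'.le hlk r) (fun r => hD'.le_cap l hlk r)
    (fun hlt r => by
      rw [partialSum_congr hsumX hagree le_rfl]
      exact hD'.step l hlt r)
    (fun r => hD'.le_box l hlk r)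
  rw [hcosteq] at hle
  have hle' : partialSum X l ≤ partialSum X' l := by
    exact_mod_cast hle.trans (cost_digitVector_partialSum_le hp hNL hX' hlk)
  have h1 := partialSum_congr hsumX hagree le_rfl
  rw [partialSum_succ X (show l < k + 1 by omega), partialSum_succ X' (show l < k + 1 by omega)] at h1
  have h2 : X (Fin.rev i) < X' (Fin.rev i) := hi2
  have h3 : X ⟨l, by omega⟩ < X' ⟨l, by omega⟩ := h2
  omega

theorem IsGreedy.unique {m : ℕ} {W : Set (Fin m → ℕ)} {G G' : Fin m → ℕ} (h : IsGreedy W G)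
    (h' : IsGreedy W G') : G = G' := by
  have h1 := le_antisymm (h'.2 G h.1) (h.2 G' h'.1)
  funext j
  have h2 := congrFun (toLex.injective h1) (Fin.rev j)
  simpa using h2

/-- If the set `tuplesU p s (k + 1) N` is not empty, its greedy element is the only element of
maximal weight. -/
theorem exists_isGreedy_tupleWeight_lt {p s k N : ℕ} (hp : 2 ≤ p) (hs : s ≠ 0)
    (hne : (tuplesU p s (k + 1) N).Nonempty) :
    ∃ G, IsGreedy (tuplesU p s (k + 1) N) G ∧
      ∀ X ∈ tuplesU p s (k + 1) N, X ≠ G → tupleWeight X < tupleWeight G := by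
  have hfin : (tuplesU p s (k + 1) N).Finite := by
    refine (Finset.piAntidiag Finset.univ N).finite_toSet.subset fun X hX => ?_
    simpa using hX.1
  obtain ⟨G, hG, hmax⟩ := hfin.exists_maximalFor tupleWeight _ hne
  have hle : ∀ X ∈ tuplesU p s (k + 1) N, tupleWeight X ≤ tupleWeight G := fun X hX => by
    by_contra hlt
    exact hlt (hmax hX (not_le.1 hlt).le)
  refine ⟨G, isGreedy_of_tupleWeight_le hp hs hG hle, fun X hX hXG => ?_⟩
  by_contra hlt
  refine hXG ((isGreedy_of_tupleWeight_le hp hs hX fun X' hX' => ?_).unique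
    (isGreedy_of_tupleWeight_le hp hs hG hle))
  exact (hle X' hX').trans (not_lt.1 hlt)

/-! ### Multinomial coefficients modulo `p` -/

/-- A multinomial coefficient is prime to `p` if and only if no carry occurs. -/
theorem not_dvd_multinomial_iff_noCarry {p m : ℕ} (hp : p.Prime) (X : Fin m → ℕ) :
    ¬ p ∣ Nat.multinomial Finset.univ X ↔ NoCarry p X := by
  set N := ∑ j, X j with hN
  have hlog : ∀ n ≤ N, Nat.log p n < N + 1 := fun n hn =>
    Nat.lt_succ_of_le ((Nat.log_le_self _ _).trans hn)
  have hle : ∀ j, X j ≤ N := fun j =>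
    Finset.single_le_sum (f := X) (fun _ _ => Nat.zero_le _) (Finset.mem_univ j)
  -- Apply Legendre's formula to `N!` and the `(X j)!`: the exponent of `p` in the multinomial
  -- coefficient vanishes iff every inequality in `hterm` is an equality.
  have h1 := congrArg (fun n => n.factorization p) (Nat.multinomial_spec Finset.univ X)
  simp only [← hN] at h1
  rw [Nat.factorization_mul (Finset.prod_ne_zero_iff.2 fun j _ => Nat.factorial_ne_zero _)
    (Nat.multinomial_pos _ _).ne', Finsupp.add_apply,
    Nat.factorization_prod_apply (fun j _ => Nat.factorial_ne_zero _),
    Nat.factorization_factorial hp (hlog N le_rfl),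
    Finset.sum_congr rfl fun j _ => Nat.factorization_factorial hp (hlog _ (hle j)),
    Finset.sum_comm] at h1
  have hterm : ∀ i ∈ Finset.Ico 1 (N + 1), ∑ j, X j / p ^ i ≤ N / p ^ i := by
    intro i _
    rw [Nat.le_div_iff_mul_le (pow_pos hp.pos i), Finset.sum_mul]
    exact Finset.sum_le_sum fun j _ => Nat.div_mul_le_self _ _
  have h2 : ¬ p ∣ Nat.multinomial Finset.univ X ↔
      (Nat.multinomial Finset.univ X).factorization p = 0 := by
    rw [Nat.factorization_eq_zero_iff]
    have := (Nat.multinomial_pos Finset.univ X).ne'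
    tauto
  rw [h2, noCarry_iff hp.pos, ← hN]
  constructor
  · intro h0 i
    rw [h0, add_zero] at h1
    have h3 := (Finset.sum_eq_sum_iff_of_le hterm).1 h1
    rcases Nat.eq_zero_or_pos i with rfl | hi
    · simp [hN]
    · rcases lt_or_ge i (N + 1) with hiN | hiN
      · exact (h3 i (Finset.mem_Ico.2 ⟨hi, hiN⟩)).symm
      · have hlt : N < p ^ i := (Nat.lt_of_succ_le hiN).trans (Nat.lt_pow_self hp.one_lt)
        rw [Nat.div_eq_of_lt hlt, Finset.sum_eq_zero]
        exact fun j _ => Nat.div_eq_of_lt ((hle j).trans_lt hlt)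
  · intro h0
    rw [Finset.sum_congr rfl fun i _ => h0 i] at h1
    omega

/-! ### Expansion of the power sums -/

section

variable {F : Type*} [Field F]

/-- The expansion of the power sum over the polynomials with coefficients from given sets. -/
theorem sum_piFinset_pow {m : ℕ} (A : Fin m → Finset F) (N : ℕ) :
    ∑ a ∈ Fintype.piFinset A, (∑ i, C (a i) * X ^ (i : ℕ) : F[X]) ^ N =
      ∑ x ∈ Finset.piAntidiag Finset.univ N,
        C ((Nat.multinomial Finset.univ x : F) * ∏ i, ∑ c ∈ A i, c ^ x i) *
          X ^ (∑ i : Fin m, (i : ℕ) * x i) := by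
  simp_rw [Finset.sum_pow_eq_sum_piAntidiag]
  rw [Finset.sum_comm]
  refine Finset.sum_congr rfl fun x _ => ?_
  have h : ∀ a : Fin m → F, (Nat.multinomial Finset.univ x : F[X]) *
      ∏ i, (C (a i) * X ^ (i : ℕ)) ^ x i = C (Nat.multinomial Finset.univ x : F) *
        C (∏ i, a i ^ x i) * X ^ (∑ i : Fin m, (i : ℕ) * x i) := by
    intro a
    simp_rw [mul_pow, ← pow_mul]
    rw [Finset.prod_mul_distrib, Finset.prod_pow_eq_pow_sum, map_prod, map_natCast]
    simp_rw [map_pow]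
    ring
  rw [Finset.sum_congr rfl fun a _ => h a, ← Finset.sum_mul, ← Finset.mul_sum, ← map_sum,
    Finset.prod_univ_sum, map_mul]

theorem coeff_sum_C_mul_X_pow {m : ℕ} (a : Fin m → F) (n : ℕ) :
    (∑ i, C (a i) * X ^ (i : ℕ) : F[X]).coeff n = if h : n < m then a ⟨n, h⟩ else 0 := by
  simp only [finsetSum_coeff, coeff_C_mul, coeff_X_pow]
  split_ifs with h
  · rw [Finset.sum_eq_single ⟨n, h⟩]
    · simp
    · intro i _ hi
      rw [if_neg, mul_zero]
      rintro rfl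
      exact hi rfl
    · simp
  · refine Finset.sum_eq_zero fun i _ => ?_
    rw [if_neg, mul_zero]
    have := i.isLt
    omega

theorem sum_C_mul_X_pow_injective (m : ℕ) :
    Function.Injective fun a : Fin m → F => (∑ i, C (a i) * X ^ (i : ℕ) : F[X]) := by
  intro a b hab
  funext i
  have := congrArg (fun P : F[X] => P.coeff i) hab
  dsimp only at this
  rw [coeff_sum_C_mul_X_pow, coeff_sum_C_mul_X_pow, dif_pos i.isLt, dif_pos i.isLt] at this
  exact this

theorem sum_coeff_C_mul_X_pow {m : ℕ} {P : F[X]} (hP : P.degree < m) :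
    ∑ i : Fin m, C (P.coeff i) * X ^ (i : ℕ) = P := by
  ext n
  rw [coeff_sum_C_mul_X_pow]
  split_ifs with h
  · rfl
  · exact (coeff_eq_zero_of_degree_lt (hP.trans_le (by exact_mod_cast not_lt.1 h))).symm

/-- A sum of monomials in which exactly one of the nonzero terms has maximal degree. -/
theorem ne_zero_and_natDegree_sum_C_mul_X_pow {ι : Type*} {S : Finset ι} {c : ι → F} {w : ι → ℕ}
    {x₀ : ι} (hx₀ : x₀ ∈ S) (hc : c x₀ ≠ 0)
    (hlt : ∀ x ∈ S, c x ≠ 0 → x ≠ x₀ → w x < w x₀) :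
    ∑ x ∈ S, C (c x) * X ^ w x ≠ 0 ∧ (∑ x ∈ S, C (c x) * X ^ w x).natDegree = w x₀ := by
  have hcoeff : (∑ x ∈ S, C (c x) * X ^ w x).coeff (w x₀) = c x₀ := by
    simp only [finsetSum_coeff, coeff_C_mul, coeff_X_pow]
    rw [Finset.sum_eq_single x₀]
    · simp
    · intro x hx hne
      by_cases hcx : c x = 0
      · simp [hcx]
      · rw [if_neg (hlt x hx hcx hne).ne', mul_zero]
    · exact fun h => absurd hx₀ h
  refine ⟨fun h => hc ?_, le_antisymm ?_ ?_⟩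
  · rw [← hcoeff, h, coeff_zero]
  · refine natDegree_sum_le_of_forall_le _ _ fun x hx => ?_
    by_cases hcx : c x = 0
    · simp [hcx]
    · refine (natDegree_C_mul_X_pow_le _ _).trans ?_
      by_cases hne : x = x₀
      · rw [hne]
      · exact (hlt x hx hcx hne).le
  · exact le_natDegree_of_ne_zero (by rwa [hcoeff])

end

/-- For `n = 0` the convention `0 ^ 0 = 1` makes the sum the cardinality of `F`, which is zero in
`F`; hence the positivity of entries. -/
theorem sum_univ_pow_ne_zero_iff {F : Type*} [Field F] [Fintype F] {q : ℕ} (hF : Nat.card F = q) (n : ℕ) :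
    ∑ c : F, c ^ n ≠ 0 ↔ 0 < n ∧ q - 1 ∣ n := by
  classical
  rw [Nat.card_eq_fintype_card] at hF
  rcases Nat.eq_zero_or_pos n with rfl | hn
  · simp
  · have h1 : ∑ c : F, c ^ n = ∑ u : Fˣ, (u ^ n : F) := by
      rw [← Finset.sum_subset (Finset.subset_univ (Finset.univ.erase (0 : F)))]
      · refine (Finset.sum_bij (fun (u : Fˣ) _ => (u : F)) ?_ ?_ ?_ ?_).symm
        · intro u _; simp
        · intro u _ v _ h; exact Units.ext h
        · intro c hc; exact ⟨Units.mk0 c (Finset.ne_of_mem_erase hc), Finset.mem_univ _, rfl⟩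
        · intro u _; rfl
      · intro c _ hc
        have : c = 0 := by simpa using hc
        rw [this, zero_pow hn.ne']
    rw [h1, FiniteField.sum_pow_units, hF]
    simp [hn]

section

variable {F : Type*} [Field F] [Finite F]

theorem charP_of_card_eq {p s : ℕ} (hp : p.Prime) (hF : Nat.card F = p ^ s) : CharP F p := by
  have := Fintype.ofFinite F
  obtain ⟨p', hp'⟩ := CharP.exists F
  obtain ⟨n, hpn, hn⟩ := FiniteField.card F p'
  rw [← Nat.card_eq_fintype_card, hF] at hn
  have h1 : p' ∣ p ^ s := hn ▸ dvd_pow_self p' n.ne_zero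
  rwa [(Nat.prime_dvd_prime_iff_eq hpn hp).1 (hpn.dvd_of_dvd_pow h1)] at hp'

theorem natCast_multinomial_ne_zero_iff {p s m : ℕ} (hp : p.Prime) (hF : Nat.card F = p ^ s)
    (x : Fin m → ℕ) : (Nat.multinomial Finset.univ x : F) ≠ 0 ↔ NoCarry p x := by
  have := charP_of_card_eq hp hF
  rw [Ne, CharP.cast_eq_zero_iff F p, not_dvd_multinomial_iff_noCarry hp]

theorem powerSum_eq [Fintype F] (k N : ℕ) :
    powerSum F k N = ∑ x ∈ Finset.piAntidiag Finset.univ N,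
      C ((Nat.multinomial Finset.univ x : F) * ∏ i : Fin k, ∑ c : F, c ^ x i) *
        X ^ (∑ i : Fin k, (i : ℕ) * x i) := by
  classical
  rw [← sum_piFinset_pow (fun _ => Finset.univ), powerSum]
  refine (Finset.sum_nbij (fun a => ∑ i : Fin _, C (a i) * X ^ (i : ℕ)) ?_ ?_ ?_ ?_).symm
  · intro a _
    simp only [Set.Finite.mem_toFinset, Set.mem_ofPred_eq]
    refine (degree_lt_iff_coeff_zero _ _).2 fun n hn => ?_
    rw [coeff_sum_C_mul_X_pow, dif_neg (by omega)]
  · exact (sum_C_mul_X_pow_injective k).injOn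
  · intro P hP
    simp only [Set.Finite.coe_toFinset, Set.mem_ofPred_eq] at hP
    exact ⟨fun i => P.coeff i, by simp, sum_coeff_C_mul_X_pow hP⟩
  · intro a _; rfl

theorem monicPowerSum_eq [Fintype F] (k N : ℕ) :
    monicPowerSum F k N = ∑ x ∈ Finset.piAntidiag Finset.univ N,
      C ((Nat.multinomial Finset.univ x : F) * ∏ i : Fin k, ∑ c : F, c ^ x i.castSucc) *
        X ^ (∑ i : Fin (k + 1), (i : ℕ) * x i) := by
  classical
  -- The leading coefficient ranges over `{1}` only, so it puts no condition on the last exponent.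
  have h := sum_piFinset_pow (Fin.snoc (fun _ => Finset.univ) {1} : Fin (k + 1) → Finset F) N
  simp only [Fin.prod_univ_castSucc, Fin.snoc_castSucc, Fin.snoc_last, Finset.sum_singleton,
    one_pow, mul_one] at h
  rw [← h, monicPowerSum]
  have hmem : ∀ a : Fin (k + 1) → F, a ∈ Fintype.piFinset
      (Fin.snoc (fun _ => Finset.univ) {1} : Fin (k + 1) → Finset F) ↔ a (Fin.last k) = 1 := by
    intro a
    rw [Fintype.mem_piFinset, Fin.forall_fin_succ']
    simp
  refine (Finset.sum_nbij (fun a => ∑ i : Fin _, C (a i) * X ^ (i : ℕ)) ?_ ?_ ?_ ?_).symm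
  · intro a ha
    rw [hmem] at ha
    simp only [Set.Finite.mem_toFinset, Set.mem_ofPred_eq]
    have hk : (∑ i, C (a i) * X ^ (i : ℕ) : F[X]).coeff k = 1 := by
      rw [coeff_sum_C_mul_X_pow, dif_pos (by omega)]
      exact ha
    have hle : (∑ i, C (a i) * X ^ (i : ℕ) : F[X]).degree ≤ k := by
      refine (degree_le_iff_coeff_zero _ _).2 fun n hn => ?_
      rw [coeff_sum_C_mul_X_pow, dif_neg]
      have : k < n := by exact_mod_cast hn
      omega
    have hdeg : (∑ i, C (a i) * X ^ (i : ℕ) : F[X]).degree = k :=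
      le_antisymm hle (le_degree_of_ne_zero (by rw [hk]; exact one_ne_zero))
    exact ⟨by rw [Monic, leadingCoeff, natDegree_eq_of_degree_eq_some hdeg, hk], hdeg⟩
  · exact (sum_C_mul_X_pow_injective (k + 1)).injOn
  · intro P hP
    simp only [Set.Finite.coe_toFinset, Set.mem_ofPred_eq] at hP
    refine ⟨fun i => P.coeff i, ?_, sum_coeff_C_mul_X_pow ?_⟩
    · rw [Finset.mem_coe, hmem]
      have := hP.1
      rwa [Monic, leadingCoeff, natDegree_eq_of_degree_eq_some hP.2] at this
    · rw [hP.2]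
      exact_mod_cast Nat.lt_succ_self k
  · intro a _; rfl

theorem tupleWeight_eq_add_sum {m : ℕ} (x : Fin m → ℕ) :
    tupleWeight x = ∑ i : Fin m, (i : ℕ) * x i + ∑ i, x i := by
  rw [tupleWeight, ← Finset.sum_add_distrib]
  exact Finset.sum_congr rfl fun i _ => by ring

theorem mem_tuplesU_succ_iff {p s k N : ℕ} (x : Fin (k + 1) → ℕ) :
    x ∈ tuplesU p s (k + 1) N ↔ ∑ i, x i = N ∧ NoCarry p x ∧
      ∀ i : Fin k, 0 < x i.castSucc ∧ p ^ s - 1 ∣ x i.castSucc := by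
  unfold tuplesU
  rw [Set.mem_ofPred_eq, Fin.forall_fin_succ']
  simp

theorem monicPowerSum_coeff_ne_zero_iff [Fintype F] {p s k N : ℕ} (hp : p.Prime)
    (hF : Nat.card F = p ^ s) {x : Fin (k + 1) → ℕ} (hx : ∑ i, x i = N) :
    (Nat.multinomial Finset.univ x : F) * ∏ i : Fin k, ∑ c : F, c ^ x i.castSucc ≠ 0 ↔
      x ∈ tuplesU p s (k + 1) N := by
  rw [mul_ne_zero_iff, natCast_multinomial_ne_zero_iff hp hF, Finset.prod_ne_zero_iff,
    mem_tuplesU_succ_iff]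
  simp only [sum_univ_pow_ne_zero_iff hF, Finset.mem_univ, true_imp_iff, hx, true_and]

theorem monicPowerSum_ne_zero_and_natDegree {p s k N : ℕ} (hp : p.Prime)
    (hF : Nat.card F = p ^ s) {G : Fin (k + 1) → ℕ} (hG : G ∈ tuplesU p s (k + 1) N)
    (hlt : ∀ x ∈ tuplesU p s (k + 1) N, x ≠ G → tupleWeight x < tupleWeight G) :
    monicPowerSum F k N ≠ 0 ∧
      (monicPowerSum F k N).natDegree = ∑ i : Fin (k + 1), (i : ℕ) * G i := by
  have := Fintype.ofFinite F
  rw [monicPowerSum_eq]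
  refine ne_zero_and_natDegree_sum_C_mul_X_pow (by simpa using hG.1)
    ((monicPowerSum_coeff_ne_zero_iff hp hF hG.1).2 hG) fun x hx hcx hne => ?_
  have hxN : ∑ i, x i = N := by simpa using hx
  have h := hlt x ((monicPowerSum_coeff_ne_zero_iff hp hF hxN).1 hcx) hne
  rw [tupleWeight_eq_add_sum, tupleWeight_eq_add_sum, hxN, hG.1] at h
  omega

theorem monicPowerSum_eq_zero {p s k N : ℕ} (hp : p.Prime) (hF : Nat.card F = p ^ s)
    (h : ¬ (tuplesU p s (k + 1) N).Nonempty) : monicPowerSum F k N = 0 := by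
  have := Fintype.ofFinite F
  rw [monicPowerSum_eq]
  refine Finset.sum_eq_zero fun x hx => ?_
  by_cases hcx : (Nat.multinomial Finset.univ x : F) * ∏ i : Fin k, ∑ c : F, c ^ x i.castSucc = 0
  · rw [hcx, C_0, zero_mul]
  · exact absurd ⟨x, (monicPowerSum_coeff_ne_zero_iff hp hF (by simpa using hx)).1 hcx⟩ h

/-- Here the last entry must be a multiple of `p ^ s - 1` too; given the other entries, this amounts
to `p ^ s - 1 ∣ N`. -/
theorem powerSum_coeff_ne_zero_iff [Fintype F] {p s k N : ℕ} (hp : p.Prime)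
    (hF : Nat.card F = p ^ s) {x : Fin (k + 1) → ℕ} (hx : ∑ i, x i = N) :
    (Nat.multinomial Finset.univ x : F) * ∏ i, ∑ c : F, c ^ x i ≠ 0 ↔
      x ∈ validCompositions p s (k + 1) N ∧ p ^ s - 1 ∣ N := by
  rw [mul_ne_zero_iff, natCast_multinomial_ne_zero_iff hp hF, Finset.prod_ne_zero_iff]
  simp only [sum_univ_pow_ne_zero_iff hF, Finset.mem_univ, true_imp_iff]
  constructor
  · rintro ⟨h1, h2⟩
    exact ⟨⟨fun j => (h2 j).1, hx, h1, fun j _ => (h2 j).2⟩,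
      hx ▸ Finset.dvd_sum fun j _ => (h2 j).2⟩
  · rintro ⟨⟨h1, -, h2, h3⟩, h4⟩
    refine ⟨h2, fun j => ⟨h1 j, ?_⟩⟩
    have h5 : ∀ i : Fin k, p ^ s - 1 ∣ x i.castSucc := fun i => h3 _ (by simp)
    rw [← hx, Fin.sum_univ_castSucc] at h4
    have h6 := (Nat.dvd_add_right (Finset.dvd_sum fun i (_ : i ∈ Finset.univ) => h5 i)).1 h4
    exact Fin.lastCases h6 h5 j

theorem powerSum_ne_zero_iff {p s : ℕ} (hp : p.Prime) (hs : s ≠ 0) (hF : Nat.card F = p ^ s)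
    (k : ℕ) {N : ℕ} (hN : 0 < N) :
    powerSum F k N ≠ 0 ↔ (validCompositions p s k N).Nonempty ∧ p ^ s - 1 ∣ N := by
  have := Fintype.ofFinite F
  rw [powerSum_eq]
  rcases k with - | k
  -- For `k = 0` the only tuple is empty, with sum `0 ≠ N`.
  · have hanti : Finset.piAntidiag (Finset.univ : Finset (Fin 0)) N = ∅ := by
      ext x
      simp [hN.ne]
    rw [hanti, Finset.sum_empty]
    refine iff_of_false (by simp) ?_
    rintro ⟨⟨x, -, hx, -⟩, -⟩
    simp at hx
    omega
  · constructor
    · intro h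
      obtain ⟨x, hx, hx0⟩ := Finset.exists_ne_zero_of_sum_ne_zero h
      have h1 := (powerSum_coeff_ne_zero_iff hp hF (by simpa using hx)).1
        (fun h0 => hx0 (by rw [h0, C_0, zero_mul]))
      exact ⟨⟨x, h1.1⟩, h1.2⟩
    · rintro ⟨⟨x, hx⟩, hdvd⟩
      have hsub : ∀ x ∈ validCompositions p s (k + 1) N, x ∈ tuplesU p s (k + 1) N :=
        fun x hx => ⟨hx.2.1, hx.2.2.1, fun j hj => ⟨hx.1 j, hx.2.2.2 j hj⟩⟩
      obtain ⟨G, hG, hlt⟩ := exists_isGreedy_tupleWeight_lt hp.two_le hs ⟨x, hsub x hx⟩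
      -- The greedy order compares last entries first, so the last entry of `G` is positive because
      -- that of `x` is.
      have hlast : x (Fin.last k) ≤ G (Fin.last k) := by
        have := Pi.apply_le_of_toLex (i := (0 : Fin (k + 1))) (hG.2 x (hsub x hx)) (by simp)
        simpa using this
      have hGV : G ∈ validCompositions p s (k + 1) N := by
        refine ⟨fun j => ?_, hG.1.1, hG.1.2.1, fun j hj => (hG.1.2.2 j hj).2⟩
        exact Fin.lastCases ((hx.1 _).trans_le hlast)
          (fun i => (hG.1.2.2 i.castSucc (by simp)).1) j
      refine (ne_zero_and_natDegree_sum_C_mul_X_pow (x₀ := G) (by simpa using hG.1.1)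
        ((powerSum_coeff_ne_zero_iff hp hF hG.1.1).2 ⟨hGV, hdvd⟩) fun y hy hcy hne => ?_).1
      have hyN : ∑ i, y i = N := by simpa using hy
      have h := hlt y (hsub y ((powerSum_coeff_ne_zero_iff hp hF hyN).1 hcy).1) hne
      rw [tupleWeight_eq_add_sum, tupleWeight_eq_add_sum, hyN, hG.1.1] at h
      omega

end

theorem theorem1p4 (p s : ℕ) (hp : p.Prime) (F : Type*) [Field F] [Finite F]
    (hF : Nat.card F = p ^ s) (k N : ℕ) (hN : 0 < N) :
    (monicPowerSum F k N ≠ 0 ↔ (tuplesU p s (k + 1) N).Nonempty) ∧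
    (powerSum F k N ≠ 0 ↔ (validCompositions p s k N).Nonempty ∧ p ^ s - 1 ∣ N) ∧
    (monicPowerSum F k N ≠ 0 →
      (∃! G : Fin (k + 1) → ℕ, IsGreedy (tuplesU p s (k + 1) N) G) ∧
      ∀ G : Fin (k + 1) → ℕ, IsGreedy (tuplesU p s (k + 1) N) G →
        ((monicPowerSum F k N).natDegree : ℤ) = (tupleWeight G : ℤ) - (N : ℤ)) := by
  have hs : s ≠ 0 := by
    rintro rfl
    rw [pow_zero] at hF
    exact absurd hF Finite.one_lt_card.ne'
  have hiff : monicPowerSum F k N ≠ 0 ↔ (tuplesU p s (k + 1) N).Nonempty := by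
    refine ⟨fun h => ?_, fun h => ?_⟩
    · by_contra hne
      exact h (monicPowerSum_eq_zero hp hF hne)
    · obtain ⟨G, hG, hlt⟩ := exists_isGreedy_tupleWeight_lt hp.two_le hs h
      exact (monicPowerSum_ne_zero_and_natDegree hp hF hG.1 hlt).1
  refine ⟨hiff, powerSum_ne_zero_iff hp hs hF k hN, fun h => ?_⟩
  obtain ⟨G, hG, hlt⟩ := exists_isGreedy_tupleWeight_lt hp.two_le hs (hiff.1 h)
  refine ⟨⟨G, hG, fun G' hG' => hG'.unique hG⟩, fun G' hG' => ?_⟩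
  rw [hG'.unique hG, (monicPowerSum_ne_zero_and_natDegree hp hF hG.1 hlt).2,
    tupleWeight_eq_add_sum G, hG.1.1]
  push_cast
  ring
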